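/- Theorem 3.1 (thm:spectral). There are absolute constants $c, C, C' > 0$ such that the following holds. Let $n \ge 1$, $1 \le d \le m$ and $\gamma \ge 0$. Let $\boldsymbol A \in \mathbb R^{d\times m}$ have rank $d$, with largest and smallest singular values $\sigma_{\max}(\boldsymbol A)$ and $\sigma_{\min}(\boldsymbol A) > 0$, and put $\kappa := \sigma_{\max}(\boldsymbol A)/\sigma_{\min}(\boldsymbol A)$. Let $\boldsymbol O_1,\dots,\boldsymbol O_n \in \mathrm{O}(d)$ be orthogonal matrices, let $\sigma \ge 0$, and suppose we observe $$\boldsymbol A_i = \boldsymbol O_i \boldsymbol A + \sigma \boldsymbol W_i, \qquad 1\le i\le n,$$ where $\boldsymbol W_1,\dots,\boldsymbol W_n$ are random $d\times m$ matrices all of whose entries are independent standard Gaussian $\mathcal N(0,1)$ variables. Let $\boldsymbol D \in \mathbb R^{nd\times m}$ be the matrix with blocks $\boldsymbol A_1,\dots,\boldsymbol A_n$ stacked vertically. Let the columns of $\boldsymbol U \in \mathbb R^{nd\times d}$ be top $d$ left singular vectors of $\boldsymbol D$ (orthonormal, the first $d$ left singular vectors of a singular value decomposition of $\boldsymbol D$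 with decreasing singular values), with $d\times d$ blocks $\boldsymbol U_1,\dots,\boldsymbol U_n$, and let $\boldsymbol S_i^0 = \mathcal P(\boldsymbol U_i)$, where $\mathcal P(\boldsymbol X) = \boldsymbol L\boldsymbol R^\top$ for a singular value decomposition $\boldsymbol X = \boldsymbol L\boldsymbol \Sigma\boldsymbol R^\top$ of a $d \times d$ matrix. If $$\sigma \le c\,\frac{\sigma_{\min}(\boldsymbol A)}{\kappa^4}\cdot\frac{\sqrt n}{\sqrt{nd}+\sqrt m+\sqrt{2\gamma n\log n}},$$ then, with probability at least $1 - C' n^{-\gamma+2}$, $$\min_{\boldsymbol Q\in \mathrm{O}(d)}\ \max_{1\le i\le n}\ \|\boldsymbol S_i^0 - \boldsymbol O_i\boldsymbol Q\| \le C\,\frac{\sigma\kappa^2}{\sigma_{\min}(\boldsymbol A)}\cdot\frac{\sqrt{nd}+\sqrt m+\sqrt{2\gamma n\log n}}{\sqrt n},$$ whatever choices are made of the singular vectors that define $\boldsymbol U$ and $\mathcal P$. Here $\|\cdot\|$ is the operator norm. -/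

import Mathlib

open MeasureTheory ProbabilityTheory
open scoped Matrix Matrix.Norms.L2Operator

namespace Procrustes

/-- `M = U diag(s) Vᵀ` is a (thin) singular value decomposition of the real matrix `M`: the columns
of `U` and of `V` are orthonormal, and `s` is non-negative and sorted in decreasing order. -/
structure IsSVD {ι κ : Type*} [Fintype ι] [Fintype κ] {r : ℕ} (M : Matrix ι κ ℝ)
    (U : Matrix ι (Fin r) ℝ) (s : Fin r → ℝ) (V : Matrix κ (Fin r) ℝ) : Prop where
  left_orthonormal : Uᵀ * U = 1
  right_orthonormal : Vᵀ * V = 1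
  nonneg : ∀ k, 0 ≤ s k
  antitone : Antitone s
  eq_mul : M = U * Matrix.diagonal s * Vᵀ

/-- The columns of `U` are the top `d` left singular vectors of `M`, i.e. the first `d` columns of
the left factor of some singular value decomposition of `M`. (They are determined by `M` only up to
the usual ambiguity: signs, and rotations inside repeated singular values.) -/
def IsTopLeftSingularVectors {ι κ : Type*} [Fintype ι] [Fintype κ] {d : ℕ} (M : Matrix ι κ ℝ)
    (U : Matrix ι (Fin d) ℝ) : Prop :=
  ∃ (r : ℕ) (h : d ≤ r) (U' : Matrix ι (Fin r) ℝ) (s : Fin r → ℝ) (V : Matrix κ (Fin r) ℝ),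
    IsSVD M U' s V ∧ U = U'.submatrix id (Fin.castLE h)

/-- `P` is a value of the rounding map `𝒫(X) = U Vᵀ`, where `U` and `V` are the orthogonal matrices
of left and right singular vectors of the square matrix `X`. It is unique when `X` is invertible. -/
def IsPolarRounding {d : ℕ} (X P : Matrix (Fin d) (Fin d) ℝ) : Prop :=
  ∃ (U : Matrix (Fin d) (Fin d) ℝ) (s : Fin d → ℝ) (V : Matrix (Fin d) (Fin d) ℝ),
    IsSVD X U s V ∧ P = U * Vᵀ

/-- The `i`-th `d × d` block of an `nd × d` matrix. -/
def block {n d : ℕ} (X : Matrix (Fin n × Fin d) (Fin d) ℝ) (i : Fin n) :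
    Matrix (Fin d) (Fin d) ℝ :=
  X.submatrix (fun a => (i, a)) id

/-- `S = (S₁, …, Sₙ)` is a spectral estimator computed from the data matrix `D`: the blockwise
rounding of the top `d` left singular vectors of `D`. -/
def IsSpectralEstimator {n d m : ℕ} (D : Matrix (Fin n × Fin d) (Fin m) ℝ)
    (S : Fin n → Matrix (Fin d) (Fin d) ℝ) : Prop :=
  ∃ U : Matrix (Fin n × Fin d) (Fin d) ℝ,
    IsTopLeftSingularVectors D U ∧ ∀ i, IsPolarRounding (block U i) (S i)

/-- The `nd × m` data matrix whose `i`-th `d × m` block is the point cloud `Oᵢ A + σ Wᵢ`. -/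
def dataMatrix {n d m : ℕ} (O : Fin n → Matrix (Fin d) (Fin d) ℝ) (A : Matrix (Fin d) (Fin m) ℝ)
    (σ : ℝ) (W : Fin n → Matrix (Fin d) (Fin m) ℝ) : Matrix (Fin n × Fin d) (Fin m) ℝ :=
  Matrix.of fun p b => (O p.1 * A + σ • W p.1) p.2 b

/-- The largest singular value of `A`. -/
noncomputable def sigmaMax {d m : ℕ} (A : Matrix (Fin d) (Fin m) ℝ) : ℝ :=
  (Matrix.toEuclideanLin A).singularValues 0

/-- The smallest, i.e. the `d`-th largest, singular value of a `d × m` matrix `A` with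
`1 ≤ d ≤ m` (singular values are numbered from zero here). -/
noncomputable def sigmaMin {d m : ℕ} (A : Matrix (Fin d) (Fin m) ℝ) : ℝ :=
  (Matrix.toEuclideanLin A).singularValues (d - 1)

/-- The condition number `κ = σ_max(A) / σ_min(A)`. -/
noncomputable def condNumber {d m : ℕ} (A : Matrix (Fin d) (Fin m) ℝ) : ℝ :=
  sigmaMax A / sigmaMin A

/-- The quantity `√(nd) + √m + √(2 γ n log n)`. -/
noncomputable def noiseScale (n d m : ℕ) (γ : ℝ) : ℝ :=
  √((n : ℝ) * d) + √(m : ℝ) + √(2 * γ * n * Real.log n)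

end Procrustes

/-! Write `D` as `stack O * A + σ • stack W`, and let `V` hold its top `d` right singular vectors
and `Y` the inverses of the top singular values. Then `U = D V Y`, so `√n Uᵢ = Oᵢ H + √n σ Wᵢ V Y`
with `H = √n A V Y` the same for every block. The top singular values are at least of order `√n
σ_min`, so everything reduces to bounding `‖Wᵢ V‖` for all `i`. The trivial bound `‖Wᵢ‖ ≤ ‖stack W‖`
is too large by a factor `√n`, and `V` depends on `Wᵢ`.

The dependence is removed by leaving one block out. Let `V₀` be a top frame of the data with `Wᵢ`
replaced by zero. It is independent of `Wᵢ`, so `Wᵢ V₀` behaves like a `d × d` Gaussian matrix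
(`measure_exists_frame_norm_ge_le`). A Davis-Kahan bound (`IsTopFrame.perturbation`) controls the
distance from `V` to the span of `V₀` by the change of Gram matrix applied to `V`. That change again
contains `Wᵢ V`, but with a small coefficient, so the inequality closes on itself
(`norm_block_mul_frame_le`).

Once the blocks are uniformly close to `Oᵢ H`, orthonormality of `U` forces `H` to be nearly
orthogonal, and rounding costs only a constant factor (`exists_orthogonal_of_blocks_close`). The
Gaussian norms come from half-nets and a union bound. -/

namespace Procrustes

/-! ### Euclidean norms and the operator norm of real matrices -/

section Basics

variable {ι κ l : Type*} [Fintype ι] [Fintype κ] [Fintype l]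

lemma dotProduct_self_eq_norm_sq (x : ι → ℝ) : x ⬝ᵥ x = ‖(WithLp.toLp 2 x : EuclideanSpace ℝ ι)‖ ^ 2 := by
  rw [EuclideanSpace.norm_sq_eq]
  simp [dotProduct, sq]

lemma dotProduct_self_nonneg' (x : ι → ℝ) : 0 ≤ x ⬝ᵥ x := by
  rw [dotProduct_self_eq_norm_sq]; positivity

lemma dotProduct_sq_le (x y : ι → ℝ) : (x ⬝ᵥ y) ^ 2 ≤ (x ⬝ᵥ x) * (y ⬝ᵥ y) := by
  simpa [dotProduct, sq] using Finset.sum_mul_sq_le_sq_mul_sq Finset.univ x y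

lemma mulVec_dotProduct_mulVec (M : Matrix ι κ ℝ) (N : Matrix ι l ℝ) (x : κ → ℝ) (y : l → ℝ) :
    (M *ᵥ x) ⬝ᵥ (N *ᵥ y) = x ⬝ᵥ ((Mᵀ * N) *ᵥ y) := by
  rw [← Matrix.mulVec_mulVec, Matrix.dotProduct_mulVec, Matrix.dotProduct_mulVec,
    Matrix.vecMul_transpose, Matrix.dotProduct_mulVec]

lemma exists_mulVec_eq_zero_of_card_lt (M : Matrix ι κ ℝ) (h : Fintype.card ι < Fintype.card κ) :
    ∃ v ≠ 0, M *ᵥ v = 0 := by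
  have := LinearMap.ker_ne_bot_of_finrank_lt (f := M.mulVecLin) (by simpa using h)
  obtain ⟨v, hv, hne⟩ := Submodule.exists_mem_ne_zero_of_ne_bot this
  exact ⟨v, hne, by simpa using hv⟩

variable [DecidableEq κ]

lemma mulVec_sq_le (M : Matrix ι κ ℝ) (x : κ → ℝ) :
    (M *ᵥ x) ⬝ᵥ (M *ᵥ x) ≤ ‖M‖ ^ 2 * (x ⬝ᵥ x) := by
  rw [dotProduct_self_eq_norm_sq, dotProduct_self_eq_norm_sq, ← mul_pow]
  exact pow_le_pow_left₀ (norm_nonneg _) (Matrix.l2_opNorm_mulVec M (WithLp.toLp 2 x)) 2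

lemma l2_opNorm_le_of_sq {M : Matrix ι κ ℝ} {c : ℝ} (hc : 0 ≤ c)
    (h : ∀ x, (M *ᵥ x) ⬝ᵥ (M *ᵥ x) ≤ c ^ 2 * (x ⬝ᵥ x)) : ‖M‖ ≤ c := by
  rw [Matrix.l2_opNorm_def]
  refine ContinuousLinearMap.opNorm_le_bound _ hc fun x => ?_
  have := h x.ofLp
  rw [dotProduct_self_eq_norm_sq, dotProduct_self_eq_norm_sq, ← mul_pow] at this
  exact le_of_sq_le_sq this (by positivity)

lemma l2_opNorm_transpose [DecidableEq ι] (M : Matrix ι κ ℝ) : ‖Mᵀ‖ = ‖M‖ := by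
  rw [← Matrix.conjTranspose_eq_transpose_of_trivial, Matrix.l2_opNorm_conjTranspose]

lemma orthonormal_mulVec_sq {U : Matrix ι κ ℝ} (hU : Uᵀ * U = 1) (x : κ → ℝ) :
    (U *ᵥ x) ⬝ᵥ (U *ᵥ x) = x ⬝ᵥ x := by
  rw [mulVec_dotProduct_mulVec, hU, Matrix.one_mulVec]

lemma orthonormal_norm_le {U : Matrix ι κ ℝ} (hU : Uᵀ * U = 1) : ‖U‖ ≤ 1 :=
  l2_opNorm_le_of_sq zero_le_one fun x => by rw [orthonormal_mulVec_sq hU]; simp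

lemma orthonormal_transpose_mulVec_sq_le [DecidableEq ι] {U : Matrix ι κ ℝ} (hU : Uᵀ * U = 1)
    (x : ι → ℝ) : (Uᵀ *ᵥ x) ⬝ᵥ (Uᵀ *ᵥ x) ≤ x ⬝ᵥ x := by
  have h := mulVec_sq_le Uᵀ x
  rw [l2_opNorm_transpose] at h
  have h1 : ‖U‖ ^ 2 ≤ 1 := pow_le_one₀ (norm_nonneg _) (orthonormal_norm_le hU)
  nlinarith [dotProduct_self_nonneg' x]

lemma orthonormal_mul_norm [DecidableEq l] {U : Matrix ι κ ℝ} (hU : Uᵀ * U = 1) (M : Matrix κ l ℝ) :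
    ‖U * M‖ = ‖M‖ := by
  have key : ∀ x, ((U * M) *ᵥ x) ⬝ᵥ ((U * M) *ᵥ x) = (M *ᵥ x) ⬝ᵥ (M *ᵥ x) := fun x => by
    rw [← Matrix.mulVec_mulVec, orthonormal_mulVec_sq hU]
  refine le_antisymm (l2_opNorm_le_of_sq (norm_nonneg _) fun x => ?_)
    (l2_opNorm_le_of_sq (norm_nonneg _) fun x => ?_)
  · rw [key]; exact mulVec_sq_le M x
  · rw [← key]; exact mulVec_sq_le _ x

end Basics

lemma exists_spectral_decomposition {ι : Type*} [Fintype ι] {m : ℕ} (D : Matrix ι (Fin m) ℝ) :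
    ∃ V : Matrix (Fin m) (Fin m) ℝ, Vᵀ * V = 1 ∧
      Dᵀ * D = V * Matrix.diagonal
        (fun k : Fin m => (Matrix.toEuclideanLin D).singularValues k ^ 2) * Vᵀ := by
  classical
  set T := Matrix.toEuclideanLin D
  have hn : Module.finrank ℝ (EuclideanSpace ℝ (Fin m)) = m := by simp
  set b := T.isSymmetric_adjoint_comp_self.eigenvectorBasis hn with hb
  have hTb : ∀ k, (Dᵀ * D) *ᵥ (b k).ofLp = (T.singularValues k ^ 2) • (b k).ofLp := by
    intro k
    have := T.isSymmetric_adjoint_comp_self.apply_eigenvectorBasis hn k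
    rw [← T.sq_singularValues_fin hn k, ← hb] at this
    have h2 := congrArg WithLp.ofLp this
    have h3 : LinearMap.adjoint T = Matrix.toEuclideanLin Dᴴ :=
      (Matrix.toEuclideanLin_conjTranspose_eq_adjoint D).symm
    rw [h3] at h2
    rw [← Matrix.mulVec_mulVec]
    exact h2
  set V : Matrix (Fin m) (Fin m) ℝ := Matrix.of fun a k => (b k).ofLp a with hV
  have hVV : Vᵀ * V = 1 := by
    ext j k
    have := orthonormal_iff_ite.1 b.orthonormal j k
    rw [Matrix.one_apply, ← this, PiLp.inner_apply, Matrix.mul_apply]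
    exact Finset.sum_congr rfl fun x _ => mul_comm _ _
  refine ⟨V, hVV, ?_⟩
  have hDV : Dᵀ * D * V = V * Matrix.diagonal
        (fun k : Fin m => T.singularValues k ^ 2) := by
    ext a k
    rw [Matrix.mul_diagonal]
    rw [mul_comm (V a k)]
    exact congrFun (hTb k) a
  rw [← hDV, Matrix.mul_assoc, mul_eq_one_comm.1 hVV, Matrix.mul_one]

/-- The columns of `V` are an orthonormal basis of an invariant subspace of `Dᵀ D` on which the
quadratic form `‖D x‖²` is at least `a ‖x‖²`. -/
def IsTopFrame {ι κ : Type*} [Fintype ι] [Fintype κ] {d : ℕ} (D : Matrix ι κ ℝ) (a : ℝ)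
    (V : Matrix κ (Fin d) ℝ) : Prop :=
  Vᵀ * V = 1 ∧ Dᵀ * D * V = V * (Vᵀ * (Dᵀ * D * V)) ∧
    ∀ y, a * (y ⬝ᵥ y) ≤ (D *ᵥ (V *ᵥ y)) ⬝ᵥ (D *ᵥ (V *ᵥ y))

/-! ### Top frames: variational bounds, perturbation, uniqueness -/

section Frames

variable {ι κ : Type*} [Fintype ι] [Fintype κ] [DecidableEq κ] {d : ℕ}

/-- Courant-Fischer: by a dimension count the range of `F` contains a nonzero vector orthogonal to
the first `k` columns of `V'`, where the form is at most `ev k`. The columns of `V'` need not span,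
so Bessel's inequality and `0 ≤ ev k` finish the comparison. -/
lemma le_of_quadratic_lower_bound {r : ℕ} {D : Matrix ι κ ℝ} {V' : Matrix κ (Fin r) ℝ}
    {ev : Fin r → ℝ} (hV' : V'ᵀ * V' = 1) (hD : Dᵀ * D = V' * Matrix.diagonal ev * V'ᵀ)
    (hev : Antitone ev) (hev0 : ∀ k, 0 ≤ ev k) (hdr : d ≤ r) {a : ℝ} {F : Matrix κ (Fin d) ℝ}
    (hF : Fᵀ * F = 1) (hDF : ∀ y, a * (y ⬝ᵥ y) ≤ (D *ᵥ (F *ᵥ y)) ⬝ᵥ (D *ᵥ (F *ᵥ y)))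
    (k : Fin d) : a ≤ ev (Fin.castLE hdr k) := by
  obtain ⟨y, hy0, hy⟩ := exists_mulVec_eq_zero_of_card_lt
    (Matrix.of fun (j : Fin k) (i : Fin d) => (V'ᵀ * F) (Fin.castLE (k.2.le.trans hdr) j) i)
    (by simp)
  set c := V'ᵀ *ᵥ (F *ᵥ y) with hc
  have hc0 : ∀ j : Fin r, (j : ℕ) < k → c j = 0 := by
    intro j hj
    have := congrFun hy ⟨j, hj⟩
    rw [hc, Matrix.mulVec_mulVec]
    simpa [Matrix.mulVec, dotProduct] using this
  have hpos : 0 < y ⬝ᵥ y := by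
    rw [dotProduct_self_eq_norm_sq]
    have : (WithLp.toLp 2 y : EuclideanSpace ℝ (Fin d)) ≠ 0 := by simpa using hy0
    positivity
  have h1 : (D *ᵥ (F *ᵥ y)) ⬝ᵥ (D *ᵥ (F *ᵥ y)) = ∑ j, ev j * (c j * c j) := by
    rw [mulVec_dotProduct_mulVec, hD, ← Matrix.mulVec_mulVec, ← Matrix.mulVec_mulVec,
      Matrix.dotProduct_mulVec, ← Matrix.mulVec_transpose, ← hc, dotProduct]
    refine Finset.sum_congr rfl fun j _ => ?_
    rw [Matrix.mulVec_diagonal]; ring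
  have h2 : ∑ j, ev j * (c j * c j) ≤ ev (Fin.castLE hdr k) * (c ⬝ᵥ c) := by
    rw [dotProduct, Finset.mul_sum]
    refine Finset.sum_le_sum fun j _ => ?_
    rcases lt_or_ge (j : ℕ) k with h | h
    · simp [hc0 j h]
    · exact mul_le_mul_of_nonneg_right (hev (by simpa [Fin.le_def] using h)) (mul_self_nonneg _)
  have h3 : c ⬝ᵥ c ≤ y ⬝ᵥ y := by
    rw [← orthonormal_mulVec_sq hF y]; exact orthonormal_transpose_mulVec_sq_le hV' _
  have h4 := hDF y
  have h5 := mul_le_mul_of_nonneg_left h3 (hev0 (Fin.castLE hdr k))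
  exact le_of_mul_le_mul_right (by linarith) hpos

/-- Allowing any number `r` of columns covers both a full eigenbasis of `Dᵀ D` and an arbitrary thin
singular value decomposition. `F` only witnesses that the top `d` eigenvalues are at least `a`. -/
lemma IsTopFrame.of_decomposition {r : ℕ} {D : Matrix ι κ ℝ} {V' : Matrix κ (Fin r) ℝ}
    {ev : Fin r → ℝ} (hV' : V'ᵀ * V' = 1) (hD : Dᵀ * D = V' * Matrix.diagonal ev * V'ᵀ)
    (hev : Antitone ev) (hev0 : ∀ k, 0 ≤ ev k) (hdr : d ≤ r) {a : ℝ} {F : Matrix κ (Fin d) ℝ}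
    (hF : Fᵀ * F = 1) (hDF : ∀ y, a * (y ⬝ᵥ y) ≤ (D *ᵥ (F *ᵥ y)) ⬝ᵥ (D *ᵥ (F *ᵥ y))) :
    IsTopFrame D a (V'.submatrix id (Fin.castLE hdr)) := by
  have hle := le_of_quadratic_lower_bound hV' hD hev hev0 hdr hF hDF
  set V := V'.submatrix id (Fin.castLE hdr) with hV
  have h1 : Vᵀ * V = 1 := by
    ext i j
    have := congrFun (congrFun hV' (Fin.castLE hdr i)) (Fin.castLE hdr j)
    simp only [Matrix.mul_apply, Matrix.one_apply, Matrix.transpose_apply] at this ⊢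
    simpa [hV] using this
  have h2 : Dᵀ * D * V = V * Matrix.diagonal (fun k => ev (Fin.castLE hdr k)) := by
    have : Dᵀ * D * V' = V' * Matrix.diagonal ev := by
      rw [hD, Matrix.mul_assoc, hV', Matrix.mul_one]
    ext i j
    have := congrFun (congrFun this i) (Fin.castLE hdr j)
    rw [Matrix.mul_diagonal] at this ⊢
    simpa [Matrix.mul_apply, hV] using this
  refine ⟨h1, ?_, fun y => ?_⟩
  · rw [h2, ← Matrix.mul_assoc Vᵀ, h1, Matrix.one_mul]
  · rw [mulVec_dotProduct_mulVec, Matrix.mulVec_mulVec, h2, mulVec_dotProduct_mulVec,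
      ← Matrix.mul_assoc, h1, Matrix.one_mul, dotProduct, dotProduct, Finset.mul_sum]
    refine Finset.sum_le_sum fun j _ => ?_
    rw [Matrix.mulVec_diagonal]
    nlinarith [mul_self_nonneg (y j), hle j]

lemma exists_isTopFrame {m : ℕ} (D : Matrix ι (Fin m) ℝ) (hdm : d ≤ m) {a : ℝ}
    {F : Matrix (Fin m) (Fin d) ℝ} (hF : Fᵀ * F = 1)
    (hDF : ∀ y, a * (y ⬝ᵥ y) ≤ (D *ᵥ (F *ᵥ y)) ⬝ᵥ (D *ᵥ (F *ᵥ y))) :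
    ∃ V : Matrix (Fin m) (Fin d) ℝ, IsTopFrame D a V := by
  obtain ⟨V', hV', hD⟩ := exists_spectral_decomposition D
  refine ⟨_, IsTopFrame.of_decomposition hV' hD (fun i j hij => ?_) (fun k => sq_nonneg _) hdm hF hDF⟩
  exact pow_le_pow_left₀ (LinearMap.singularValues_nonneg _ _)
    (LinearMap.singularValues_antitone _ hij) 2

/-- Off the top frame, a matrix of rank `d` plus a perturbation is as small as the perturbation. -/
lemma IsTopFrame.mulVec_sq_le_of_orthogonal {D E : Matrix ι κ ℝ} {L : Matrix ι (Fin d) ℝ}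
    {A : Matrix (Fin d) κ ℝ} (hD : D = L * A + E) {a e : ℝ} (hE : ‖E‖ ≤ e) (hea : e ^ 2 < a)
    {V : Matrix κ (Fin d) ℝ} (hV : IsTopFrame D a V) {v : κ → ℝ} (hv : Vᵀ *ᵥ v = 0) :
    (D *ᵥ v) ⬝ᵥ (D *ᵥ v) ≤ e ^ 2 * (v ⬝ᵥ v) := by
  obtain ⟨hVV, hinv, hlow⟩ := hV
  by_contra! hcon
  -- The columns of `V` together with `v` give `d + 1` vectors, which `A` maps into dimension `d`.
  -- Some nontrivial combination `u` is therefore killed by `A`, and there `D` acts as `E`.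
  let M : Matrix (Fin d) (Option (Fin d)) ℝ :=
    Matrix.of fun i o => o.elim ((A *ᵥ v) i) (fun j => (A * V) i j)
  obtain ⟨c, hc0, hc⟩ := exists_mulVec_eq_zero_of_card_lt M (by simp)
  set y : Fin d → ℝ := fun j => c (some j) with hy
  set t := c none with ht
  set u := V *ᵥ y + t • v with hu
  have hAu : A *ᵥ u = 0 := by
    ext i
    have := congrFun hc i
    simp only [Matrix.mulVec, dotProduct, Fintype.sum_option, M] at this
    rw [hu, Matrix.mulVec_add, Matrix.mulVec_smul, Matrix.mulVec_mulVec]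
    simp only [Pi.add_apply, Pi.smul_apply, smul_eq_mul, Pi.zero_apply]
    simp only [Matrix.of_apply, Option.elim, Pi.zero_apply] at this
    rw [← this]
    simp [Matrix.mulVec, dotProduct, hy, ht]; ring
  have hDu : (D *ᵥ u) ⬝ᵥ (D *ᵥ u) ≤ e ^ 2 * (u ⬝ᵥ u) := by
    have : D *ᵥ u = E *ᵥ u := by
      rw [hD, Matrix.add_mulVec, ← Matrix.mulVec_mulVec, hAu]; simp
    rw [this]
    exact (mulVec_sq_le E u).trans (mul_le_mul_of_nonneg_right
      (pow_le_pow_left₀ (norm_nonneg _) hE 2) (dotProduct_self_nonneg' u))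
  have hcross : (V *ᵥ y) ⬝ᵥ v = 0 := by
    rw [dotProduct_comm, Matrix.dotProduct_mulVec, ← Matrix.mulVec_transpose, hv]; simp
  have hcrossD : (D *ᵥ (V *ᵥ y)) ⬝ᵥ (D *ᵥ v) = 0 := by
    rw [dotProduct_comm, mulVec_dotProduct_mulVec, Matrix.mulVec_mulVec, hinv,
      ← Matrix.mulVec_mulVec, Matrix.dotProduct_mulVec, ← Matrix.mulVec_transpose, hv]; simp
  have e1 : u ⬝ᵥ u = y ⬝ᵥ y + t ^ 2 * (v ⬝ᵥ v) := by
    rw [hu, add_dotProduct, dotProduct_add, dotProduct_add, orthonormal_mulVec_sq hVV]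
    simp only [smul_dotProduct, dotProduct_smul, hcross, dotProduct_comm v, smul_eq_mul]; ring
  have e2 : (D *ᵥ u) ⬝ᵥ (D *ᵥ u) = (D *ᵥ (V *ᵥ y)) ⬝ᵥ (D *ᵥ (V *ᵥ y))
      + t ^ 2 * ((D *ᵥ v) ⬝ᵥ (D *ᵥ v)) := by
    rw [hu, Matrix.mulVec_add, Matrix.mulVec_smul, add_dotProduct, dotProduct_add, dotProduct_add]
    simp only [smul_dotProduct, dotProduct_smul, hcrossD, dotProduct_comm (D *ᵥ v), smul_eq_mul]
    ring
  have hl := hlow y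
  have hyy := dotProduct_self_nonneg' y
  have k1 : 0 ≤ (a - e ^ 2) * (y ⬝ᵥ y) := mul_nonneg (by linarith) hyy
  have k2 : 0 ≤ t ^ 2 * ((D *ᵥ v) ⬝ᵥ (D *ᵥ v) - e ^ 2 * (v ⬝ᵥ v)) :=
    mul_nonneg (sq_nonneg t) (by linarith)
  rw [e1, e2] at hDu
  -- The quantities in `k1` and `k2` are nonnegative, while `hDu` makes their sum nonpositive. Both
  -- vanish, which makes the combination trivial.
  have k3 : (a - e ^ 2) * (y ⬝ᵥ y) = 0 := by nlinarith
  have k4 : t ^ 2 * ((D *ᵥ v) ⬝ᵥ (D *ᵥ v) - e ^ 2 * (v ⬝ᵥ v)) = 0 := by nlinarith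
  have t0 : t = 0 := by
    rcases mul_eq_zero.1 k4 with h | h
    · exact pow_eq_zero_iff (two_ne_zero) |>.1 h
    · linarith
  have y0 : y = 0 := by
    rcases mul_eq_zero.1 k3 with h | h
    · linarith
    · exact dotProduct_self_eq_zero.1 h
  refine hc0 (funext fun o => ?_)
  cases o with
  | none => exact t0
  | some j => exact congrFun y0 j

/-- A Davis-Kahan type bound for top frames. -/
lemma IsTopFrame.perturbation {D₀ E D : Matrix ι κ ℝ} {L : Matrix ι (Fin d) ℝ}
    {A : Matrix (Fin d) κ ℝ} (hD₀ : D₀ = L * A + E) {a e : ℝ} (hE : ‖E‖ ≤ e) (hea : e ^ 2 < a)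
    {V₀ V : Matrix κ (Fin d) ℝ} (hV₀ : IsTopFrame D₀ a V₀) (hV : IsTopFrame D a V) :
    (a - e ^ 2) * ‖V - V₀ * (V₀ᵀ * V)‖ ≤ ‖(Dᵀ * D - D₀ᵀ * D₀) * V‖ := by
  classical
  have ha : 0 < a := lt_of_le_of_lt (sq_nonneg e) hea
  have he : 0 ≤ e := (norm_nonneg _).trans hE
  obtain ⟨Q, hQ⟩ : ∃ Q : Matrix κ κ ℝ, Q = 1 - V₀ * V₀ᵀ := ⟨_, rfl⟩
  obtain ⟨G, hG⟩ : ∃ G : Matrix κ κ ℝ, G = D₀ᵀ * D₀ := ⟨_, rfl⟩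
  rw [← hG]
  set M := Vᵀ * (Dᵀ * D * V) with hM
  set z := V - V₀ * (V₀ᵀ * V) with hz
  have hzQ : z = Q * V := by rw [hz, hQ, Matrix.sub_mul, Matrix.one_mul, Matrix.mul_assoc]
  have hQT : Qᵀ = Q := by
    rw [hQ, Matrix.transpose_sub, Matrix.transpose_mul, Matrix.transpose_transpose,
      Matrix.transpose_one]
  have hGT : Gᵀ = G := by rw [hG, Matrix.transpose_mul, Matrix.transpose_transpose]
  have hV₀Q : V₀ᵀ * Q = 0 := by
    rw [hQ, Matrix.mul_sub, ← Matrix.mul_assoc, hV₀.1, Matrix.one_mul, Matrix.mul_one, sub_self]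
  have hQQ : Q * Q = Q := by
    nth_rw 1 [hQ]
    rw [Matrix.sub_mul, Matrix.mul_assoc, hV₀Q, Matrix.one_mul, Matrix.mul_zero, sub_zero]
  have hQnorm : ‖Q‖ ≤ 1 := by
    refine l2_opNorm_le_of_sq zero_le_one fun x => ?_
    rw [mulVec_dotProduct_mulVec, hQT, hQQ, hQ, Matrix.sub_mulVec, dotProduct_sub,
      Matrix.one_mulVec, ← Matrix.mulVec_mulVec, Matrix.dotProduct_mulVec,
      ← Matrix.mulVec_transpose]
    linarith [dotProduct_self_nonneg' (V₀ᵀ *ᵥ x)]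
  have hGV : G * V₀ = V₀ * (V₀ᵀ * (G * V₀)) := by rw [hG]; exact hV₀.2.1
  have hQG : Q * G = G * Q := by
    have h1 : Q * G * V₀ = 0 := by
      rw [Matrix.mul_assoc, hGV, ← Matrix.mul_assoc, hQ, Matrix.sub_mul, Matrix.mul_assoc V₀,
        hV₀.1]; simp
    have h2 : Q * G * Q = Q * G := by
      have : Q * G * (1 - V₀ * V₀ᵀ) = Q * G := by
        rw [Matrix.mul_sub, ← Matrix.mul_assoc, h1]; simp
      rwa [← hQ] at this
    have h3 := congrArg Matrix.transpose h2
    simp only [Matrix.transpose_mul, hQT, hGT] at h3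
    rw [← h2, ← h3, ← Matrix.mul_assoc]
  have hD₀Q : ‖D₀ * Q‖ ≤ e := by
    refine l2_opNorm_le_of_sq he fun x => ?_
    rw [← Matrix.mulVec_mulVec]
    refine (hV₀.mulVec_sq_le_of_orthogonal hD₀ hE hea (v := Q *ᵥ x) ?_).trans ?_
    · rw [Matrix.mulVec_mulVec, hV₀Q, Matrix.zero_mulVec]
    · refine mul_le_mul_of_nonneg_left ((mulVec_sq_le Q x).trans ?_) (sq_nonneg e)
      have := pow_le_one₀ (n := 2) (norm_nonneg _) hQnorm
      nlinarith [dotProduct_self_nonneg' x]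
  have hGz : ‖G * z‖ ≤ e ^ 2 * ‖z‖ := by
    have : G * z = (D₀ * Q)ᵀ * ((D₀ * Q) * z) := by
      have h1 : (D₀ * Q)ᵀ * ((D₀ * Q) * z) = Q * (D₀ᵀ * D₀) * (Q * Q) * V := by
        rw [Matrix.transpose_mul, hQT, hzQ]; simp only [Matrix.mul_assoc]
      rw [h1, ← hG, hQQ, hQG, Matrix.mul_assoc G, hQQ, hzQ, Matrix.mul_assoc]
    rw [this]
    calc _ ≤ ‖(D₀ * Q)ᵀ‖ * (‖D₀ * Q‖ * ‖z‖) :=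
          (Matrix.l2_opNorm_mul _ _).trans (mul_le_mul_of_nonneg_left (Matrix.l2_opNorm_mul _ _)
            (norm_nonneg _))
      _ ≤ e * (e * ‖z‖) := by
          rw [l2_opNorm_transpose]; gcongr
      _ = _ := by ring
  have hMT : Mᵀ = M := by
    rw [hM]; simp only [Matrix.transpose_mul, Matrix.transpose_transpose, Matrix.mul_assoc]
  -- A Sylvester equation for `z`: the form of `M` is at least `a`, whereas `G` is at most `e ^ 2`
  -- on the range of `Q`. Comparing the two sides yields the gap `a - e ^ 2`.
  have hzM : z * M = Q * ((Dᵀ * D - G) * V) + G * z := by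
    have h1 : G * (Q * V) = Q * (G * V) := by
      rw [← Matrix.mul_assoc, ← hQG, Matrix.mul_assoc]
    rw [hzQ, Matrix.mul_assoc Q, ← hV.2.1, Matrix.sub_mul _ G, Matrix.mul_sub Q, h1]
    abel
  have hlow : a * ‖z‖ ≤ ‖z * M‖ := by
    rw [mul_comm, ← le_div_iff₀ ha, ← l2_opNorm_transpose z]
    refine l2_opNorm_le_of_sq (by positivity) fun x => ?_
    set p := zᵀ *ᵥ x with hp
    have h1 : a * (p ⬝ᵥ p) ≤ p ⬝ᵥ (M *ᵥ p) := by
      refine (hV.2.2 p).trans_eq ?_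
      rw [Matrix.mulVec_mulVec, mulVec_dotProduct_mulVec, hM, Matrix.transpose_mul]
      simp only [Matrix.mul_assoc]
    have h2 := dotProduct_sq_le p (M *ᵥ p)
    have h3 : (M *ᵥ p) ⬝ᵥ (M *ᵥ p) ≤ ‖z * M‖ ^ 2 * (x ⬝ᵥ x) := by
      have : M *ᵥ p = (z * M)ᵀ *ᵥ x := by
        rw [Matrix.transpose_mul, hMT, hp, Matrix.mulVec_mulVec]
      rw [this, ← l2_opNorm_transpose (z * M)]
      exact mulVec_sq_le _ x
    have hpp := dotProduct_self_nonneg' p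
    rcases hpp.eq_or_lt with h0 | h0
    · rw [← h0]; have := dotProduct_self_nonneg' x; positivity
    · rw [div_pow, div_mul_eq_mul_div, le_div_iff₀ (by positivity)]
      have h4 : (a * (p ⬝ᵥ p)) ^ 2 ≤ (p ⬝ᵥ p) * ((M *ᵥ p) ⬝ᵥ (M *ᵥ p)) :=
        (pow_le_pow_left₀ (by positivity) h1 2).trans h2
      have h5 : (p ⬝ᵥ p) * a ^ 2 ≤ (M *ᵥ p) ⬝ᵥ (M *ᵥ p) :=
        le_of_mul_le_mul_left (by nlinarith) h0
      linarith
  have hfin : ‖z * M‖ ≤ ‖(Dᵀ * D - G) * V‖ + e ^ 2 * ‖z‖ := by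
    rw [hzM]
    refine (norm_add_le _ _).trans (add_le_add ?_ hGz)
    refine (Matrix.l2_opNorm_mul _ _).trans ?_
    exact mul_le_of_le_one_left (norm_nonneg _) hQnorm
  linarith

/-- The case of equal matrices in the perturbation bound: the spectral gap determines the span of a
top frame. Hence one frame can stand for all of them. -/
lemma IsTopFrame.eq_mul_of_isTopFrame {D E : Matrix ι κ ℝ} {L : Matrix ι (Fin d) ℝ}
    {A : Matrix (Fin d) κ ℝ} (hD : D = L * A + E) {a e : ℝ} (hE : ‖E‖ ≤ e) (hea : e ^ 2 < a)
    {V₀ V : Matrix κ (Fin d) ℝ} (hV₀ : IsTopFrame D a V₀) (hV : IsTopFrame D a V) :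
    V = V₀ * (V₀ᵀ * V) := by
  have h := hV₀.perturbation hD hE hea hV
  rw [sub_self, Matrix.zero_mul, norm_zero] at h
  have : ‖V - V₀ * (V₀ᵀ * V)‖ = 0 :=
    le_antisymm (nonpos_of_mul_nonpos_right h (by linarith)) (norm_nonneg _)
  exact sub_eq_zero.1 (norm_eq_zero.1 this)

end Frames

/-! ### Extreme singular values of `A` -/

section SingularValues

variable {d m : ℕ}

lemma norm_le_sigmaMax (A : Matrix (Fin d) (Fin m) ℝ) : ‖A‖ ≤ sigmaMax A := by
  obtain ⟨V, hV, hA⟩ := exists_spectral_decomposition A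
  refine l2_opNorm_le_of_sq (LinearMap.singularValues_nonneg _ _) fun x => ?_
  set c := Vᵀ *ᵥ x with hc
  have h1 : (A *ᵥ x) ⬝ᵥ (A *ᵥ x) =
      ∑ j : Fin m, (Matrix.toEuclideanLin A).singularValues j ^ 2 * (c j * c j) := by
    rw [mulVec_dotProduct_mulVec, hA, ← Matrix.mulVec_mulVec, ← Matrix.mulVec_mulVec,
      Matrix.dotProduct_mulVec, ← Matrix.mulVec_transpose, ← hc, dotProduct]
    refine Finset.sum_congr rfl fun j _ => ?_
    rw [Matrix.mulVec_diagonal]; ring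
  rw [h1]
  refine le_trans ?_ (mul_le_mul_of_nonneg_left (orthonormal_transpose_mulVec_sq_le hV x)
    (sq_nonneg _))
  rw [← hc, dotProduct, Finset.mul_sum]
  refine Finset.sum_le_sum fun j _ => mul_le_mul_of_nonneg_right ?_ (mul_self_nonneg _)
  exact pow_le_pow_left₀ (LinearMap.singularValues_nonneg _ _)
    (LinearMap.singularValues_antitone _ (Nat.zero_le _)) 2

lemma sigmaMin_le_sigmaMax (A : Matrix (Fin d) (Fin m) ℝ) : sigmaMin A ≤ sigmaMax A :=
  LinearMap.singularValues_antitone _ (Nat.zero_le _)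

lemma exists_frame_sigmaMin (hdm : d ≤ m) (A : Matrix (Fin d) (Fin m) ℝ) :
    ∃ F : Matrix (Fin m) (Fin d) ℝ, Fᵀ * F = 1 ∧
      ∀ y, sigmaMin A ^ 2 * (y ⬝ᵥ y) ≤ (A *ᵥ (F *ᵥ y)) ⬝ᵥ (A *ᵥ (F *ᵥ y)) := by
  obtain ⟨V, hV, hA⟩ := exists_spectral_decomposition A
  set F := V.submatrix id (Fin.castLE hdm) with hF
  have h1 : Fᵀ * F = 1 := by
    ext i j
    have := congrFun (congrFun hV (Fin.castLE hdm i)) (Fin.castLE hdm j)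
    simp only [Matrix.mul_apply, Matrix.one_apply, Matrix.transpose_apply] at this ⊢
    simpa [hF] using this
  have h2 : Aᵀ * A * F = F * Matrix.diagonal
      (fun k : Fin d => (Matrix.toEuclideanLin A).singularValues k ^ 2) := by
    have h := congrArg (· * V) hA
    simp only [Matrix.mul_assoc _ Vᵀ, hV, Matrix.mul_one] at h
    ext i j
    have := congrFun (congrFun h i) (Fin.castLE hdm j)
    rw [Matrix.mul_diagonal] at this ⊢
    simpa [Matrix.mul_apply, hF] using this
  refine ⟨F, h1, fun y => ?_⟩
  rw [mulVec_dotProduct_mulVec, Matrix.mulVec_mulVec, h2, mulVec_dotProduct_mulVec,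
    ← Matrix.mul_assoc, h1, Matrix.one_mul, dotProduct, dotProduct, Finset.mul_sum]
  refine Finset.sum_le_sum fun j _ => ?_
  rw [Matrix.mulVec_diagonal]
  have : sigmaMin A ^ 2 ≤ (Matrix.toEuclideanLin A).singularValues j ^ 2 :=
    pow_le_pow_left₀ (LinearMap.singularValues_nonneg _ _)
      (LinearMap.singularValues_antitone _ (by omega)) 2
  nlinarith [mul_self_nonneg (y j)]

end SingularValues

/-! ### Vertically stacked matrices -/

section Stack

variable {n d : ℕ} {κ : Type*}

/-- The matrix with the given blocks stacked vertically. -/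
def stack (X : Fin n → Matrix (Fin d) κ ℝ) : Matrix (Fin n × Fin d) κ ℝ :=
  Matrix.of fun p b => X p.1 p.2 b

lemma dataMatrix_eq_stack {m : ℕ} (O : Fin n → Matrix (Fin d) (Fin d) ℝ)
    (A : Matrix (Fin d) (Fin m) ℝ) (σ : ℝ) (W : Fin n → Matrix (Fin d) (Fin m) ℝ) :
    dataMatrix O A σ W = stack fun i => O i * A + σ • W i := rfl

lemma dataMatrix_eq_add {m : ℕ} (O : Fin n → Matrix (Fin d) (Fin d) ℝ)
    (A : Matrix (Fin d) (Fin m) ℝ) (σ : ℝ) (W : Fin n → Matrix (Fin d) (Fin m) ℝ) :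
    dataMatrix O A σ W = stack O * A + σ • stack W := by
  ext p b
  simp [dataMatrix, stack, Matrix.mul_apply]

lemma stack_transpose_mul_stack {l : Type*} (X : Fin n → Matrix (Fin d) κ ℝ)
    (Y : Fin n → Matrix (Fin d) l ℝ) : (stack X)ᵀ * stack Y = ∑ i, (X i)ᵀ * Y i := by
  ext a b
  simp [stack, Matrix.mul_apply, Matrix.sum_apply, Fintype.sum_prod_type]

variable [Fintype κ]

lemma stack_mulVec_sq (X : Fin n → Matrix (Fin d) κ ℝ) (v : κ → ℝ) :
    (stack X *ᵥ v) ⬝ᵥ (stack X *ᵥ v) = ∑ i, (X i *ᵥ v) ⬝ᵥ (X i *ᵥ v) := by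
  simp [stack, Matrix.mulVec, dotProduct, Fintype.sum_prod_type]

variable [DecidableEq κ]

lemma norm_block_le (X : Fin n → Matrix (Fin d) κ ℝ) (i : Fin n) : ‖X i‖ ≤ ‖stack X‖ := by
  refine l2_opNorm_le_of_sq (norm_nonneg _) fun x => le_trans ?_ (mulVec_sq_le (stack X) x)
  rw [stack_mulVec_sq]
  exact Finset.single_le_sum (f := fun i => (X i *ᵥ x) ⬝ᵥ (X i *ᵥ x))
    (fun j _ => dotProduct_self_nonneg' _) (Finset.mem_univ i)

lemma norm_stack_update_zero_le (X : Fin n → Matrix (Fin d) κ ℝ) (i : Fin n) :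
    ‖stack (Function.update X i 0)‖ ≤ ‖stack X‖ := by
  refine l2_opNorm_le_of_sq (norm_nonneg _) fun x => le_trans ?_ (mulVec_sq_le (stack X) x)
  rw [stack_mulVec_sq, stack_mulVec_sq]
  refine Finset.sum_le_sum fun j _ => ?_
  rcases eq_or_ne j i with rfl | h
  · simpa using dotProduct_self_nonneg' (X j *ᵥ x)
  · rw [Function.update_of_ne h]

end Stack

/-! ### Polar rounding -/

section Polar

variable {d : ℕ}

lemma orthogonal_mul_norm {l : Type*} [Fintype l] [DecidableEq l] {O : Matrix (Fin d) (Fin d) ℝ}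
    (hO : O ∈ Matrix.orthogonalGroup (Fin d) ℝ) (M : Matrix (Fin d) l ℝ) : ‖O * M‖ = ‖M‖ :=
  orthonormal_mul_norm ((Matrix.mem_orthogonalGroup_iff' _ _).1 hO) M

lemma IsPolarRounding.smul {X P : Matrix (Fin d) (Fin d) ℝ} (h : IsPolarRounding X P) {c : ℝ}
    (hc : 0 ≤ c) : IsPolarRounding (c • X) P := by
  obtain ⟨U, s, V, ⟨hU, hV, h0, hs, rfl⟩, rfl⟩ := h
  refine ⟨U, c • s, V, ⟨hU, hV, fun k => mul_nonneg hc (h0 k),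
    fun i j hij => mul_le_mul_of_nonneg_left (hs hij) hc, ?_⟩, rfl⟩
  rw [Matrix.diagonal_smul, Matrix.mul_smul, Matrix.smul_mul]

lemma IsPolarRounding.mem_orthogonalGroup {X P : Matrix (Fin d) (Fin d) ℝ}
    (h : IsPolarRounding X P) : P ∈ Matrix.orthogonalGroup (Fin d) ℝ := by
  obtain ⟨U, s, V, ⟨hU, hV, -, -, -⟩, rfl⟩ := h
  rw [Matrix.mem_orthogonalGroup_iff']
  change (U * Vᵀ)ᵀ * (U * Vᵀ) = 1
  rw [Matrix.transpose_mul, Matrix.transpose_transpose, Matrix.mul_assoc, ← Matrix.mul_assoc Uᵀ,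
    hU, Matrix.one_mul, mul_eq_one_comm.1 hV]

/-- In singular coordinates this is `|s - 1| ≤ |s ^ 2 - 1|` for `s ≥ 0`. Invertibility is not
needed, so every choice of rounding is covered. -/
lemma IsPolarRounding.norm_sub_le {X P : Matrix (Fin d) (Fin d) ℝ} (h : IsPolarRounding X P) :
    ‖X - P‖ ≤ ‖Xᵀ * X - 1‖ := by
  obtain ⟨U, s, V, ⟨hU, hV, h0, -, rfl⟩, rfl⟩ := h
  have hright : ∀ M : Matrix (Fin d) (Fin d) ℝ, ‖M * Vᵀ‖ = ‖M‖ := fun M => by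
    rw [← l2_opNorm_transpose, Matrix.transpose_mul, Matrix.transpose_transpose,
      orthonormal_mul_norm hV, l2_opNorm_transpose]
  have e1 : U * Matrix.diagonal s * Vᵀ - U * Vᵀ = U * Matrix.diagonal (s - 1) * Vᵀ := by
    have : Matrix.diagonal (s - 1) = Matrix.diagonal s - 1 := by
      rw [← Matrix.diagonal_one, Matrix.diagonal_sub]; rfl
    rw [this, Matrix.mul_sub, Matrix.sub_mul, Matrix.mul_one]
  have e2 : (U * Matrix.diagonal s * Vᵀ)ᵀ * (U * Matrix.diagonal s * Vᵀ) - 1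
      = V * Matrix.diagonal (fun k => s k * s k - 1) * Vᵀ := by
    have h1 : (U * Matrix.diagonal s * Vᵀ)ᵀ * (U * Matrix.diagonal s * Vᵀ)
        = V * (Matrix.diagonal s * (Uᵀ * U) * Matrix.diagonal s) * Vᵀ := by
      simp only [Matrix.transpose_mul, Matrix.transpose_transpose, Matrix.diagonal_transpose,
        Matrix.mul_assoc]
    have h2 : Matrix.diagonal (fun k => s k * s k - 1)
        = Matrix.diagonal s * Matrix.diagonal s - 1 := by
      rw [Matrix.diagonal_mul_diagonal, ← Matrix.diagonal_one, Matrix.diagonal_sub]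
    rw [h1, hU, Matrix.mul_one, h2, Matrix.mul_sub, Matrix.sub_mul, Matrix.mul_one,
      mul_eq_one_comm.1 hV]
  rw [e1, e2, hright, hright, orthonormal_mul_norm hU, orthonormal_mul_norm hV,
    Matrix.l2_opNorm_diagonal, Matrix.l2_opNorm_diagonal, pi_norm_le_iff_of_nonneg (norm_nonneg _)]
  intro k
  refine le_trans ?_ (norm_le_pi_norm (fun k => s k * s k - 1) k)
  have : s k * s k - 1 = (s k + 1) * (s k - 1) := by ring
  rw [Real.norm_eq_abs, Real.norm_eq_abs, this, abs_mul]
  refine le_mul_of_one_le_left (abs_nonneg _) ?_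
  rw [abs_of_nonneg (by linarith [h0 k])]; linarith [h0 k]

end Polar

/-! ### The deterministic leave-one-out argument -/

section Deterministic

variable {n d m : ℕ}

lemma sub_sq_mul_le {ι : Type*} [Fintype ι] {p q : ι → ℝ} {α e s : ℝ} (he : 0 ≤ e) (heα : e ≤ α)
    (hs : 0 ≤ s) (hp : α ^ 2 * s ≤ p ⬝ᵥ p) (hq : q ⬝ᵥ q ≤ e ^ 2 * s) :
    (α - e) ^ 2 * s ≤ (p + q) ⬝ᵥ (p + q) := by
  rw [dotProduct_self_eq_norm_sq] at *
  set P : EuclideanSpace ℝ ι := WithLp.toLp 2 p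
  set R : EuclideanSpace ℝ ι := WithLp.toLp 2 q
  have hs2 : √s ^ 2 = s := Real.sq_sqrt hs
  have h1 : α * √s ≤ ‖P‖ := by
    refine le_of_sq_le_sq ?_ (norm_nonneg _); rwa [mul_pow, hs2]
  have h2 : ‖R‖ ≤ e * √s := by
    refine le_of_sq_le_sq ?_ (by positivity); rwa [mul_pow, hs2]
  have h3 : ‖P‖ - ‖R‖ ≤ ‖P + R‖ := by
    have := norm_sub_le (P + R) R
    rw [add_sub_cancel_right] at this; linarith
  have h4 : 0 ≤ (α - e) * √s := mul_nonneg (by linarith) (Real.sqrt_nonneg _)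
  rw [WithLp.toLp_add]
  calc (α - e) ^ 2 * s = ((α - e) * √s) ^ 2 := by rw [mul_pow, hs2]
    _ ≤ ‖P + R‖ ^ 2 := pow_le_pow_left₀ h4 (by linarith) 2

lemma stack_orthogonal_mulVec_sq {O : Fin n → Matrix (Fin d) (Fin d) ℝ}
    (hO : ∀ i, O i ∈ Matrix.orthogonalGroup (Fin d) ℝ) (y : Fin d → ℝ) :
    (stack O *ᵥ y) ⬝ᵥ (stack O *ᵥ y) = n * (y ⬝ᵥ y) := by
  rw [stack_mulVec_sq]
  simp_rw [fun i => orthonormal_mulVec_sq ((Matrix.mem_orthogonalGroup_iff' _ _).1 (hO i)) y]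
  simp

/-- The top right singular vectors of `A` serve as test frame: the signal stretches them by at least
`√n σ_min`, and noise of a tenth of that size leaves `(9/10) ^ 2 ≥ 1/2` of the square. -/
lemma exists_frame_dataMatrix (hdm : d ≤ m) {A : Matrix (Fin d) (Fin m) ℝ}
    {O : Fin n → Matrix (Fin d) (Fin d) ℝ} (hO : ∀ i, O i ∈ Matrix.orthogonalGroup (Fin d) ℝ)
    {σ : ℝ} {W : Fin n → Matrix (Fin d) (Fin m) ℝ}
    (hW : ‖σ • stack W‖ ≤ √n * sigmaMin A / 10) :
    ∃ F : Matrix (Fin m) (Fin d) ℝ, Fᵀ * F = 1 ∧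
      ∀ y, n * sigmaMin A ^ 2 / 2 * (y ⬝ᵥ y) ≤
        (dataMatrix O A σ W *ᵥ (F *ᵥ y)) ⬝ᵥ (dataMatrix O A σ W *ᵥ (F *ᵥ y)) := by
  obtain ⟨F, hF, hAF⟩ := exists_frame_sigmaMin hdm A
  refine ⟨F, hF, fun y => ?_⟩
  have hmin : 0 ≤ sigmaMin A := LinearMap.singularValues_nonneg _ _
  set ρ := √n * sigmaMin A with hρ
  have hρ0 : 0 ≤ ρ := by positivity
  have hρ2 : ρ ^ 2 = n * sigmaMin A ^ 2 := by rw [hρ, mul_pow, Real.sq_sqrt (Nat.cast_nonneg n)]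
  have hy := dotProduct_self_nonneg' y
  rw [dataMatrix_eq_add, Matrix.add_mulVec, ← hρ2]
  refine le_trans ?_ (sub_sq_mul_le (α := ρ) (e := ρ / 10) (s := y ⬝ᵥ y) (by positivity)
    (by linarith) hy ?_ ?_)
  · nlinarith [sq_nonneg ρ, mul_nonneg (sq_nonneg ρ) hy]
  · rw [← Matrix.mulVec_mulVec, stack_orthogonal_mulVec_sq hO, hρ2, mul_assoc]
    exact mul_le_mul_of_nonneg_left (hAF y) (Nat.cast_nonneg n)
  · refine (mulVec_sq_le _ _).trans ?_
    rw [orthonormal_mulVec_sq hF]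
    exact mul_le_mul_of_nonneg_right (pow_le_pow_left₀ (norm_nonneg _) hW 2) hy

/-- Only the `i`-th block changes. After multiplication by `V` on the right, the first and third
terms contain `Wᵢ V`, the quantity to be bounded; this is the source of the self-bounding
inequality. -/
lemma gram_dataMatrix_sub_update {A : Matrix (Fin d) (Fin m) ℝ}
    (O : Fin n → Matrix (Fin d) (Fin d) ℝ) (σ : ℝ) (W : Fin n → Matrix (Fin d) (Fin m) ℝ)
    (i : Fin n) :
    (dataMatrix O A σ W)ᵀ * dataMatrix O A σ W -
      (dataMatrix O A σ (Function.update W i 0))ᵀ * dataMatrix O A σ (Function.update W i 0)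
    = σ • ((O i * A)ᵀ * W i) + σ • ((W i)ᵀ * (O i * A)) + σ ^ 2 • ((W i)ᵀ * W i) := by
  rw [dataMatrix_eq_stack, dataMatrix_eq_stack, stack_transpose_mul_stack,
    stack_transpose_mul_stack, ← Finset.sum_sub_distrib, Finset.sum_eq_single i]
  · rw [Function.update_self, smul_zero, add_zero, Matrix.transpose_add, Matrix.transpose_smul,
      Matrix.add_mul, Matrix.mul_add, Matrix.mul_add, Matrix.smul_mul, Matrix.smul_mul,
      Matrix.mul_smul, Matrix.mul_smul, smul_smul, ← sq]
    abel
  · intro j _ hj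
    rw [Function.update_of_ne hj, sub_self]
  · simp

/-- Here `x = ‖Wᵢ V‖`, `ζ` is the distance between the frames, `ρ = √n σ_min`, `M = σ_max` and `q =
w / √n`. The perturbation bound gives `w ζ ≤ x / 4 + q / 4`, and the multiple of `x` is absorbed on
the left. -/
lemma le_two_mul_add_of_self_bound {ρ σ w M x t q ζ : ℝ} (hρ : 0 < ρ) (hw : 0 ≤ w) (hx : 0 ≤ x)
    (ht : 0 ≤ t) (hζ : 0 ≤ ζ) (hq0 : 0 ≤ q) (hσw : (σ * w) ^ 2 ≤ ρ ^ 2 / 10000)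
    (hwM : 100 * (σ * w * M) ≤ ρ ^ 2) (hq : 100 * (w * (σ * w * M)) ≤ q * ρ ^ 2)
    (hpert : (ρ ^ 2 / 2 - (σ * w) ^ 2) * ζ ≤
      σ * (M * x) + σ * (w * M) + σ ^ 2 * (w * x))
    (hxζ : x ≤ t + w * ζ) : x ≤ 2 * t + q := by
  have k2 : 100 * (w * (σ * (M * x))) ≤ ρ ^ 2 * x := by
    calc 100 * (w * (σ * (M * x))) = 100 * (σ * w * M) * x := by ring
      _ ≤ _ := by gcongr
  have k3 : w * (σ ^ 2 * (w * x)) ≤ ρ ^ 2 / 10000 * x := by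
    calc w * (σ ^ 2 * (w * x)) = (σ * w) ^ 2 * x := by ring
      _ ≤ _ := by gcongr
  have k4 : ρ ^ 2 / 4 * ζ ≤ (ρ ^ 2 / 2 - (σ * w) ^ 2) * ζ :=
    mul_le_mul_of_nonneg_right (by linarith [sq_nonneg ρ]) hζ
  have k5 := mul_le_mul_of_nonneg_left (k4.trans hpert) hw
  have k6 : ρ ^ 2 * (w * ζ) ≤ ρ ^ 2 * (x / 4 + q / 4) := by
    have h1 : w * (ρ ^ 2 / 4 * ζ) = ρ ^ 2 * (w * ζ) / 4 := by ring
    have h2 : w * (σ * (M * x) + σ * (w * M) + σ ^ 2 * (w * x)) =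
      w * (σ * (M * x)) + w * (σ * w * M) + w * (σ ^ 2 * (w * x)) := by ring
    have h3 : ρ ^ 2 * (x / 4 + q / 4) = ρ ^ 2 * x / 4 + q * ρ ^ 2 / 4 := by ring
    have h4 : 0 ≤ ρ ^ 2 * x := by positivity
    have h5 : 0 ≤ q * ρ ^ 2 := by positivity
    rw [h1, h2] at k5; rw [h3]; linarith
  have k7 : w * ζ ≤ x / 4 + q / 4 := le_of_mul_le_mul_left k6 (by positivity)
  linarith

/-- The leave-one-out bound: if every top frame of the data without the `i`-th noise block is
nearly killed by that block, then so is every top frame of the full data. -/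
lemma norm_block_mul_frame_le (hn : 1 ≤ n) (hdm : d ≤ m)
    {A : Matrix (Fin d) (Fin m) ℝ} (hA : 0 < sigmaMin A)
    {O : Fin n → Matrix (Fin d) (Fin d) ℝ} (hO : ∀ i, O i ∈ Matrix.orthogonalGroup (Fin d) ℝ)
    {σ : ℝ} (hσ : 0 ≤ σ) {W : Fin n → Matrix (Fin d) (Fin m) ℝ} {w t : ℝ} (hW : ‖stack W‖ ≤ w)
    (hw : 100 * (σ * w * sigmaMax A) ≤ √n * sigmaMin A ^ 2) (i : Fin n)
    (ht : ∀ V₀ : Matrix (Fin m) (Fin d) ℝ, IsTopFrame (dataMatrix O A σ (Function.update W i 0))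
      (n * sigmaMin A ^ 2 / 2) V₀ → ‖W i * V₀‖ ≤ t)
    {V : Matrix (Fin m) (Fin d) ℝ}
    (hV : IsTopFrame (dataMatrix O A σ W) (n * sigmaMin A ^ 2 / 2) V) :
    ‖W i * V‖ ≤ 2 * t + w / √n := by
  have hw0 : 0 ≤ w := (norm_nonneg _).trans hW
  have hn' : (1 : ℝ) ≤ n := by exact_mod_cast hn
  have hsn : 1 ≤ √(n : ℝ) := Real.one_le_sqrt.2 hn'
  have hmm := sigmaMin_le_sigmaMax A
  set μ := sigmaMin A with hμ
  set M := sigmaMax A with hM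
  set ρ := √n * μ with hρ
  have hρ0 : 0 < ρ := by positivity
  have hρ2 : n * μ ^ 2 = ρ ^ 2 := by rw [hρ, mul_pow, Real.sq_sqrt (Nat.cast_nonneg n)]
  have hσw : 100 * (σ * w) ≤ ρ := by
    have h1 : 100 * (σ * w) * μ ≤ ρ * μ := by
      calc 100 * (σ * w) * μ ≤ 100 * (σ * w) * M := by gcongr
        _ = 100 * (σ * w * M) := by ring
        _ ≤ √n * μ ^ 2 := hw
        _ = ρ * μ := by rw [hρ]; ring
    exact le_of_mul_le_mul_right h1 hA
  have hE : ‖σ • stack (Function.update W i 0)‖ ≤ σ * w := by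
    rw [norm_smul, Real.norm_of_nonneg hσ]
    exact mul_le_mul_of_nonneg_left ((norm_stack_update_zero_le W i).trans hW) hσ
  have he : (σ * w) ^ 2 ≤ ρ ^ 2 / 10000 := by
    have := pow_le_pow_left₀ (by positivity) hσw 2
    nlinarith
  rw [hρ2] at ht hV
  obtain ⟨F, hF, hDF⟩ := exists_frame_dataMatrix hdm (A := A) (σ := σ) hO (hE.trans
    (by rw [← hμ, ← hρ]; linarith))
  rw [← hμ, hρ2] at hDF
  obtain ⟨V₀, hV₀⟩ := exists_isTopFrame _ hdm hF hDF
  have hpert := hV₀.perturbation (dataMatrix_eq_add O A σ _) hE (by nlinarith) hV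
  have htV := ht V₀ hV₀
  rw [gram_dataMatrix_sub_update] at hpert
  set z := V - V₀ * (V₀ᵀ * V) with hz
  set x := ‖W i * V‖ with hx
  have hx0 : 0 ≤ x := norm_nonneg _
  have hVn : ‖V‖ ≤ 1 := orthonormal_norm_le hV.1
  have hWi : ‖W i‖ ≤ w := (norm_block_le W i).trans hW
  have hOA : ‖O i * A‖ ≤ M := by rw [orthogonal_mul_norm (hO i)]; exact norm_le_sigmaMax A
  have hM0 : 0 ≤ M := (norm_nonneg _).trans hOA
  have hR : ‖(σ • ((O i * A)ᵀ * W i) + σ • ((W i)ᵀ * (O i * A)) + σ ^ 2 • ((W i)ᵀ * W i)) * V‖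
      ≤ σ * (M * x) + σ * (w * M) + σ ^ 2 * (w * x) := by
    rw [Matrix.add_mul, Matrix.add_mul, Matrix.smul_mul, Matrix.smul_mul, Matrix.smul_mul]
    refine norm_add₃_le.trans ?_
    rw [norm_smul, norm_smul, norm_smul, Real.norm_of_nonneg hσ,
      Real.norm_of_nonneg (sq_nonneg σ)]
    gcongr
    · rw [Matrix.mul_assoc]
      refine (Matrix.l2_opNorm_mul _ _).trans ?_
      rw [l2_opNorm_transpose]; gcongr
    · refine (Matrix.l2_opNorm_mul _ _).trans ?_
      refine (mul_le_of_le_one_right (norm_nonneg _) hVn).trans ?_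
      refine (Matrix.l2_opNorm_mul _ _).trans ?_
      rw [l2_opNorm_transpose]; gcongr
    · rw [Matrix.mul_assoc]
      refine (Matrix.l2_opNorm_mul _ _).trans ?_
      rw [l2_opNorm_transpose]; exact mul_le_mul_of_nonneg_right hWi hx0
  have hxz : x ≤ t + w * ‖z‖ := by
    have : W i * V = W i * V₀ * (V₀ᵀ * V) + W i * z := by
      rw [hz, Matrix.mul_sub, Matrix.mul_assoc]; abel
    rw [hx, this]
    refine (norm_add_le _ _).trans (add_le_add ?_ ?_)
    · refine ((Matrix.l2_opNorm_mul _ _).trans (mul_le_of_le_one_right (norm_nonneg _) ?_)).trans htV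
      refine (Matrix.l2_opNorm_mul _ _).trans (mul_le_one₀ ?_ (norm_nonneg _) hVn)
      rw [l2_opNorm_transpose]; exact orthonormal_norm_le hV₀.1
    · exact (Matrix.l2_opNorm_mul _ _).trans (by gcongr)
  have hwM : 100 * (σ * w * M) ≤ ρ ^ 2 := by
    refine hw.trans ?_
    rw [← hρ2]
    refine mul_le_mul_of_nonneg_right ?_ (sq_nonneg μ)
    exact (Real.sqrt_le_left (by linarith)).2 (le_self_pow₀ hn' two_ne_zero)
  have hq : 100 * (w * (σ * w * M)) ≤ w / √n * ρ ^ 2 := by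
    calc 100 * (w * (σ * w * M)) = w * (100 * (σ * w * M)) := by ring
      _ ≤ w * (√n * μ ^ 2) := by gcongr
      _ = w / √n * ρ ^ 2 := by rw [hρ]; field_simp
  exact le_two_mul_add_of_self_bound hρ0 hw0 hx0 ((norm_nonneg _).trans htV) (norm_nonneg z)
    (by positivity) he hwM hq (hpert.trans hR) hxz

/-- If the columns of `U` are orthonormal and its scaled blocks are close to `Oᵢ H` for one matrix
`H`, then their roundings are close to `Oᵢ Q` for one orthogonal matrix `Q`. -/
lemma exists_orthogonal_of_blocks_close (hn : 1 ≤ n)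
    {O : Fin n → Matrix (Fin d) (Fin d) ℝ} (hO : ∀ i, O i ∈ Matrix.orthogonalGroup (Fin d) ℝ)
    {U : Matrix (Fin n × Fin d) (Fin d) ℝ} (hU : Uᵀ * U = 1) {H : Matrix (Fin d) (Fin d) ℝ} {η : ℝ}
    (hη : η ≤ 1 / 10) (hUH : ∀ i, ‖√(n : ℝ) • block U i - O i * H‖ ≤ η)
    {S : Fin n → Matrix (Fin d) (Fin d) ℝ} (hS : ∀ i, IsPolarRounding (block U i) (S i)) :
    ∃ Q ∈ Matrix.orthogonalGroup (Fin d) ℝ, ∀ i, ‖S i - O i * Q‖ ≤ 20 * η := by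
  have hn' : (1 : ℝ) ≤ n := by exact_mod_cast hn
  have hη0 : 0 ≤ η := (norm_nonneg _).trans (hUH ⟨0, hn⟩)
  set X : Fin n → Matrix (Fin d) (Fin d) ℝ := fun i => √(n : ℝ) • block U i with hX
  set N : Fin n → Matrix (Fin d) (Fin d) ℝ := fun i => X i - O i * H with hN
  have hOO : ∀ i, (O i)ᵀ * O i = 1 := fun i => (Matrix.mem_orthogonalGroup_iff' _ _).1 (hO i)
  set h := ‖H‖ with hh
  have hh0 : 0 ≤ h := norm_nonneg _
  have hT : ∀ i, ‖(X i)ᵀ * X i - Hᵀ * H‖ ≤ 2 * (h * η) + η ^ 2 := by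
    intro i
    have e : (X i)ᵀ * X i - Hᵀ * H = (O i * H)ᵀ * N i + (N i)ᵀ * (O i * H) + (N i)ᵀ * N i := by
      have e1 : X i = O i * H + N i := by simp only [hN]; abel
      have e2 : (O i * H)ᵀ * (O i * H) = Hᵀ * H := by
        rw [Matrix.transpose_mul, Matrix.mul_assoc, ← Matrix.mul_assoc (O i)ᵀ, hOO, Matrix.one_mul]
      rw [e1, Matrix.transpose_add, Matrix.add_mul, Matrix.mul_add, Matrix.mul_add, e2]
      abel
    have hNi : ‖N i‖ ≤ η := hUH i
    have hOH : ‖O i * H‖ = h := orthogonal_mul_norm (hO i) H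
    rw [e]
    refine norm_add₃_le.trans ?_
    have a1 : ‖(O i * H)ᵀ * N i‖ ≤ h * η := by
      refine (Matrix.l2_opNorm_mul _ _).trans ?_
      rw [l2_opNorm_transpose, hOH]; gcongr
    have a2 : ‖(N i)ᵀ * (O i * H)‖ ≤ η * h := by
      refine (Matrix.l2_opNorm_mul _ _).trans ?_
      rw [l2_opNorm_transpose, hOH]; gcongr
    have a3 : ‖(N i)ᵀ * N i‖ ≤ η * η := by
      refine (Matrix.l2_opNorm_mul _ _).trans ?_
      rw [l2_opNorm_transpose]; gcongr
    nlinarith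
  -- Orthonormality of `U` says that the scaled block Gram matrices average to the identity, so `Hᵀ
  -- H` inherits the blockwise error bound.
  have hsum : ∑ i, ((X i)ᵀ * X i - Hᵀ * H) = (n : ℝ) • (1 - Hᵀ * H) := by
    have e1 : U = stack (block U) := rfl
    have e2 : ∑ i, (X i)ᵀ * X i = (n : ℝ) • (1 : Matrix (Fin d) (Fin d) ℝ) := by
      rw [← hU]
      conv_rhs => rw [e1]
      rw [stack_transpose_mul_stack, Finset.smul_sum]
      refine Finset.sum_congr rfl fun i _ => ?_
      rw [hX, Matrix.transpose_smul, Matrix.smul_mul, Matrix.mul_smul, smul_smul,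
        Real.mul_self_sqrt (Nat.cast_nonneg n)]
    rw [Finset.sum_sub_distrib, e2, Finset.sum_const, Finset.card_univ, Fintype.card_fin, smul_sub,
      ← Nat.cast_smul_eq_nsmul ℝ]
  have hH1 : ‖1 - Hᵀ * H‖ ≤ 2 * (h * η) + η ^ 2 := by
    have h1 : ‖(n : ℝ) • (1 - Hᵀ * H)‖ ≤ n * (2 * (h * η) + η ^ 2) := by
      rw [← hsum]
      refine (norm_sum_le _ _).trans ((Finset.sum_le_sum fun i _ => hT i).trans_eq ?_)
      rw [Finset.sum_const, Finset.card_univ, Fintype.card_fin, nsmul_eq_mul]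
    rw [norm_smul, Real.norm_of_nonneg (by linarith)] at h1
    exact le_of_mul_le_mul_left h1 (by linarith)
  -- `hH1` gives `h ^ 2 ≤ 1 + 2 h η + η ^ 2`, and `η ≤ 1 / 10` turns this into an absolute bound.
  have hh2 : h ≤ 2 := by
    have h1 : ‖Hᵀ * H‖ = h * h := by
      rw [← Matrix.conjTranspose_eq_transpose_of_trivial, Matrix.l2_opNorm_conjTranspose_mul_self]
    have h2 : ‖Hᵀ * H‖ ≤ ‖(1 : Matrix (Fin d) (Fin d) ℝ)‖ + ‖1 - Hᵀ * H‖ := by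
      have : Hᵀ * H = 1 - (1 - Hᵀ * H) := by abel
      conv_lhs => rw [this]
      exact norm_sub_le _ _
    have h3 : ‖(1 : Matrix (Fin d) (Fin d) ℝ)‖ ≤ 1 := orthonormal_norm_le (by simp)
    nlinarith
  have hXS : ∀ i, ‖X i - S i‖ ≤ 9 * η := by
    intro i
    refine ((hS i).smul (Real.sqrt_nonneg _)).norm_sub_le.trans ?_
    have e : (X i)ᵀ * X i - 1 = ((X i)ᵀ * X i - Hᵀ * H) - (1 - Hᵀ * H) := by abel
    change ‖(X i)ᵀ * X i - 1‖ ≤ _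
    rw [e]
    have := (norm_sub_le ((X i)ᵀ * X i - Hᵀ * H) (1 - Hᵀ * H)).trans (add_le_add (hT i) hH1)
    nlinarith
  have hSH : ∀ i, ‖S i - O i * H‖ ≤ 10 * η := by
    intro i
    have e : S i - O i * H = N i - (X i - S i) := by simp only [hN]; abel
    rw [e]
    have hNi : ‖N i‖ ≤ η := hUH i
    linarith [norm_sub_le (N i) (X i - S i), hXS i]
  set j : Fin n := ⟨0, hn⟩
  have hOj : (O j)ᵀ ∈ Matrix.orthogonalGroup (Fin d) ℝ := by
    rw [Matrix.mem_orthogonalGroup_iff']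
    change (O j)ᵀᵀ * (O j)ᵀ = 1
    rw [Matrix.transpose_transpose]
    exact mul_eq_one_comm.1 (hOO j)
  -- Aligning with a single reference block gives an exactly orthogonal `Q` without rounding `H`;
  -- the errors of blocks `i` and `j` add up to `20 η`.
  refine ⟨(O j)ᵀ * S j, mul_mem hOj (hS j).mem_orthogonalGroup, fun i => ?_⟩
  have e : S i - O i * ((O j)ᵀ * S j) = (S i - O i * H) - O i * ((O j)ᵀ * (S j - O j * H)) := by
    rw [Matrix.mul_sub (O j)ᵀ, Matrix.mul_sub (O i), ← Matrix.mul_assoc (O j)ᵀ (O j), hOO,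
      Matrix.one_mul]; abel
  rw [e]
  have := norm_sub_le (S i - O i * H) (O i * ((O j)ᵀ * (S j - O j * H)))
  rw [orthogonal_mul_norm (hO i), orthogonal_mul_norm hOj] at this
  linarith [hSH i, hSH j]

/-- The deterministic part of the spectral bound. -/
theorem IsSpectralEstimator.exists_orthogonal_close (hn : 1 ≤ n) (hdm : d ≤ m)
    {A : Matrix (Fin d) (Fin m) ℝ} (hA : 0 < sigmaMin A)
    {O : Fin n → Matrix (Fin d) (Fin d) ℝ} (hO : ∀ i, O i ∈ Matrix.orthogonalGroup (Fin d) ℝ)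
    {σ : ℝ} (hσ : 0 ≤ σ) {W : Fin n → Matrix (Fin d) (Fin m) ℝ} {w t : ℝ} (hW : ‖stack W‖ ≤ w)
    (hw : 100 * (σ * w * sigmaMax A) ≤ √n * sigmaMin A ^ 2)
    (ht : ∀ i, ∀ V₀ : Matrix (Fin m) (Fin d) ℝ, IsTopFrame (dataMatrix O A σ (Function.update W i 0))
      (n * sigmaMin A ^ 2 / 2) V₀ → ‖W i * V₀‖ ≤ t)
    (hsmall : 20 * (σ * (2 * t + w / √n)) ≤ sigmaMin A)
    {S : Fin n → Matrix (Fin d) (Fin d) ℝ} (hS : IsSpectralEstimator (dataMatrix O A σ W) S) :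
    ∃ Q ∈ Matrix.orthogonalGroup (Fin d) ℝ, ∀ i,
      ‖S i - O i * Q‖ ≤ 40 * (σ * (2 * t + w / √n) / sigmaMin A) := by
  obtain ⟨U, ⟨r, hdr, U', s, V', ⟨hU', hV', hs0, hs, hD⟩, rfl⟩, hSU⟩ := hS
  have hw0 : 0 ≤ w := (norm_nonneg _).trans hW
  have hn' : (1 : ℝ) ≤ n := by exact_mod_cast hn
  have hsn : 1 ≤ √(n : ℝ) := Real.one_le_sqrt.2 hn'
  have hmm := sigmaMin_le_sigmaMax A
  set μ := sigmaMin A with hμ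
  set D := dataMatrix O A σ W with hDdef
  have hE : ‖σ • stack W‖ ≤ √n * μ / 10 := by
    rw [norm_smul, Real.norm_of_nonneg hσ]
    have h1 : 100 * (σ * w) * μ ≤ (√n * μ) * μ := by
      calc 100 * (σ * w) * μ ≤ 100 * (σ * w) * sigmaMax A := by gcongr
        _ = 100 * (σ * w * sigmaMax A) := by ring
        _ ≤ √n * μ ^ 2 := hw
        _ = _ := by ring
    have h2 := le_of_mul_le_mul_right h1 hA
    have h3 := mul_le_mul_of_nonneg_left hW hσ
    have h4 : 0 ≤ √n * μ := by positivity
    linarith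
  obtain ⟨F, hF, hDF⟩ := exists_frame_dataMatrix hdm (A := A) hO hE
  have hDD : Dᵀ * D = V' * Matrix.diagonal (fun k => s k ^ 2) * V'ᵀ := by
    have h1 : Dᵀ * D = V' * (Matrix.diagonal s * (U'ᵀ * U') * Matrix.diagonal s) * V'ᵀ := by
      rw [hD]
      simp only [Matrix.transpose_mul, Matrix.transpose_transpose, Matrix.diagonal_transpose,
        Matrix.mul_assoc]
    rw [h1, hU', Matrix.mul_one, Matrix.diagonal_mul_diagonal]
    simp_rw [sq]
  have hanti : Antitone fun k => s k ^ 2 := fun i j hij =>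
    pow_le_pow_left₀ (hs0 _) (hs hij) 2
  have hlow := le_of_quadratic_lower_bound hV' hDD hanti (fun k => sq_nonneg _) hdr hF hDF
  have hV := IsTopFrame.of_decomposition hV' hDD hanti (fun k => sq_nonneg _) hdr hF hDF
  set V := V'.submatrix id (Fin.castLE hdr) with hVdef
  set U := U'.submatrix id (Fin.castLE hdr) with hUdef
  have hx : ∀ i, ‖W i * V‖ ≤ 2 * t + w / √n := fun i =>
    norm_block_mul_frame_le hn hdm hA hO hσ hW hw i (ht i) hV
  set x := 2 * t + w / √n
  have hUU : Uᵀ * U = 1 := by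
    ext i j
    have := congrFun (congrFun hU' (Fin.castLE hdr i)) (Fin.castLE hdr j)
    simp only [Matrix.mul_apply, Matrix.one_apply, Matrix.transpose_apply] at this ⊢
    simpa [hUdef] using this
  have hDV : D * V = U * Matrix.diagonal (fun k => s (Fin.castLE hdr k)) := by
    have h1 : D * V' = U' * Matrix.diagonal s := by
      rw [hD, Matrix.mul_assoc, hV', Matrix.mul_one]
    ext i j
    have := congrFun (congrFun h1 i) (Fin.castLE hdr j)
    rw [Matrix.mul_diagonal] at this ⊢
    simpa [Matrix.mul_apply, hVdef, hUdef] using this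
  have hsl : ∀ k : Fin d, √n * μ / 2 ≤ s (Fin.castLE hdr k) := fun k => by
    refine le_of_sq_le_sq (le_trans ?_ (hlow k)) (hs0 _)
    rw [div_pow, mul_pow, Real.sq_sqrt (Nat.cast_nonneg n)]
    have : 0 ≤ n * μ ^ 2 := by positivity
    linarith
  have hρ : 0 < √n * μ / 2 := by positivity
  set Y : Matrix (Fin d) (Fin d) ℝ := Matrix.diagonal fun k => (s (Fin.castLE hdr k))⁻¹ with hY
  -- This passes from left to right singular vectors, the side on which all blocks share the same
  -- `V`.
  have hDVY : U = D * V * Y := by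
    rw [hDV, Matrix.mul_assoc, hY, Matrix.diagonal_mul_diagonal]
    have : (fun k : Fin d => s (Fin.castLE hdr k) * (s (Fin.castLE hdr k))⁻¹) = fun _ => 1 :=
      funext fun k => mul_inv_cancel₀ (hρ.trans_le (hsl k)).ne'
    rw [this, Matrix.diagonal_one, Matrix.mul_one]
  have hYn : ‖Y‖ ≤ (√n * μ / 2)⁻¹ := by
    rw [hY, Matrix.l2_opNorm_diagonal, pi_norm_le_iff_of_nonneg (by positivity)]
    intro k
    rw [Real.norm_of_nonneg (inv_nonneg.2 (hs0 _))]
    exact inv_anti₀ hρ (hsl k)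
  have hblock : ∀ i, block U i = (O i * A + σ • W i) * V * Y := by
    intro i
    ext a b
    rw [hDVY]
    simp only [block, Matrix.submatrix_apply, Matrix.mul_apply, id]
    rfl
  -- The residual of each block is `√n σ Wᵢ V Y`. Since `‖Y‖ ≤ 2 / (√n μ)`, its norm is at most `2 σ
  -- x / μ`.
  have key := exists_orthogonal_of_blocks_close hn hO hUU (H := √(n : ℝ) • (A * V * Y))
    (η := 2 * (σ * x / μ)) ?_ ?_ hSU
  · obtain ⟨Q, hQ, h⟩ := key
    exact ⟨Q, hQ, fun i => (h i).trans_eq (by ring)⟩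
  · have : σ * x / μ ≤ 1 / 20 := by rw [div_le_iff₀ hA]; linarith
    linarith
  · intro i
    have e : √(n : ℝ) • block U i - O i * √(n : ℝ) • (A * V * Y)
        = (√(n : ℝ) * σ) • (W i * V * Y) := by
      rw [hblock, Matrix.mul_smul, Matrix.add_mul, Matrix.add_mul, Matrix.smul_mul,
        Matrix.smul_mul, smul_add, smul_smul, Matrix.mul_assoc (O i), Matrix.mul_assoc (O i)]
      abel
    rw [e, norm_smul, Real.norm_of_nonneg (by positivity)]
    have h1 : ‖W i * V * Y‖ ≤ x * (√n * μ / 2)⁻¹ :=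
      (Matrix.l2_opNorm_mul _ _).trans
        (mul_le_mul (hx i) hYn (norm_nonneg _) ((norm_nonneg _).trans (hx i)))
    refine (mul_le_mul_of_nonneg_left h1 (by positivity)).trans_eq ?_
    field_simp

end Deterministic

/-! ### Half-nets of unit spheres -/

section Nets

/-- Take a `1`-separated subset of the sphere of radius `2` of maximal cardinality and halve it.
Volume comparison bounds its size, and a point missed by the net could be added to the set. -/
lemma exists_half_net (E : Type*) [NormedAddCommGroup E] [NormedSpace ℝ E]
    [FiniteDimensional ℝ E] : ∃ T : Finset E, T.card ≤ 5 ^ Module.finrank ℝ E ∧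
      (∀ u ∈ T, ‖u‖ = 1) ∧ ∀ v : E, ‖v‖ = 1 → ∃ u ∈ T, ‖u - v‖ ≤ 1 / 2 := by
  classical
  let good : Finset E → Prop := fun s =>
    (∀ c ∈ s, ‖c‖ = 2) ∧ ∀ c ∈ s, ∀ c' ∈ s, c ≠ c' → 1 ≤ ‖c - c'‖
  have hbound : ∀ s, good s → s.card ≤ 5 ^ Module.finrank ℝ E := fun s hs =>
    Besicovitch.card_le_of_separated s (fun c hc => (hs.1 c hc).le) hs.2
  let K : Set ℕ := {k | ∃ s, good s ∧ s.card = k}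
  have hK : BddAbove K := ⟨5 ^ Module.finrank ℝ E, by rintro _ ⟨s, hs, rfl⟩; exact hbound s hs⟩
  obtain ⟨s, hs, hcard⟩ : sSup K ∈ K := Nat.sSup_mem ⟨0, ∅, by simp [good], rfl⟩ hK
  refine ⟨s.image fun c => (2⁻¹ : ℝ) • c, Finset.card_image_le.trans (hbound s hs), ?_, ?_⟩
  · intro u hu
    obtain ⟨c, hc, rfl⟩ := Finset.mem_image.1 hu
    rw [norm_smul, hs.1 c hc]; norm_num
  · intro v hv
    by_contra! hcon
    have hfar : ∀ c ∈ s, 1 ≤ ‖c - (2 : ℝ) • v‖ := by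
      intro c hc
      have h := hcon _ (Finset.mem_image_of_mem _ hc)
      have e : c - (2 : ℝ) • v = (2 : ℝ) • ((2⁻¹ : ℝ) • c - v) := by
        rw [smul_sub, smul_smul]; norm_num
      rw [e, norm_smul]; norm_num; linarith
    have hnot : (2 : ℝ) • v ∉ s := fun h => by
      have := hfar _ h; rw [sub_self, norm_zero] at this; linarith
    have hins : good (insert ((2 : ℝ) • v) s) := by
      refine ⟨fun c hc => ?_, fun c hc c' hc' hne => ?_⟩
      · rcases Finset.mem_insert.1 hc with rfl | hc
        · rw [norm_smul, hv]; norm_num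
        · exact hs.1 c hc
      · rcases Finset.mem_insert.1 hc with rfl | hc <;> rcases Finset.mem_insert.1 hc' with rfl | hc'
        · exact absurd rfl hne
        · rw [norm_sub_rev]; exact hfar _ hc'
        · exact hfar _ hc
        · exact hs.2 c hc c' hc' hne
    have := le_csSup hK ⟨_, hins, rfl⟩
    rw [Finset.card_insert_of_notMem hnot, hcard] at this
    omega

lemma norm_le_of_net {F : Type*} [NormedAddCommGroup F] [InnerProductSpace ℝ F] {T : Finset F}
    (hT : ∀ v : F, ‖v‖ = 1 → ∃ u ∈ T, ‖u - v‖ ≤ 1 / 2) {B : ℝ} (hB : 0 ≤ B) (p : F)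
    (h : ∀ u ∈ T, inner ℝ u p ≤ B) : ‖p‖ ≤ 2 * B := by
  rcases eq_or_ne p 0 with rfl | hp
  · simpa using hB
  obtain ⟨u, hu, huv⟩ := hT ((‖p‖⁻¹ : ℝ) • p) (norm_smul_inv_norm hp)
  have h1 : inner ℝ ((‖p‖⁻¹ : ℝ) • p) p = ‖p‖ := by
    rw [real_inner_smul_left, real_inner_self_eq_norm_sq]
    have : ‖p‖ ≠ 0 := norm_ne_zero_iff.2 hp
    field_simp
  have h2 : -(‖p‖ / 2) ≤ inner ℝ (u - (‖p‖⁻¹ : ℝ) • p) p := by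
    have := neg_le_of_abs_le (abs_real_inner_le_norm (u - (‖p‖⁻¹ : ℝ) • p) p)
    have := mul_le_mul_of_nonneg_right huv (norm_nonneg p)
    linarith
  rw [inner_sub_left, h1] at h2
  linarith [h u hu]

/-- Each of the two nets costs a factor `2`. -/
lemma opNorm_le_of_nets {E F : Type*} [NormedAddCommGroup E] [NormedSpace ℝ E]
    [NormedAddCommGroup F] [InnerProductSpace ℝ F] {T₁ : Finset F} {T₂ : Finset E}
    (hT₁ : ∀ v : F, ‖v‖ = 1 → ∃ u ∈ T₁, ‖u - v‖ ≤ 1 / 2)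
    (hT₂ : ∀ v : E, ‖v‖ = 1 → ∃ u ∈ T₂, ‖u - v‖ ≤ 1 / 2) {B : ℝ} (hB : 0 ≤ B) (f : E →L[ℝ] F)
    (h : ∀ u ∈ T₁, ∀ v ∈ T₂, inner ℝ u (f v) ≤ B) : ‖f‖ ≤ 4 * B := by
  have key : ‖f‖ ≤ 2 * B + ‖f‖ / 2 := by
    refine ContinuousLinearMap.opNorm_le_of_unit_norm (by positivity) fun x hx => ?_
    obtain ⟨v, hv, hvx⟩ := hT₂ x hx
    have h1 := norm_le_of_net hT₁ hB (f v) fun u hu => h u hu v hv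
    have h2 : ‖f (v - x)‖ ≤ ‖f‖ * (1 / 2) :=
      (f.le_opNorm _).trans (mul_le_mul_of_nonneg_left hvx (norm_nonneg _))
    have h3 : f x = f v - f (v - x) := by rw [map_sub]; abel
    rw [h3]
    linarith [norm_sub_le (f v) (f (v - x))]
  linarith

end Nets

/-! ### Gaussian operator norm tails -/

section Tails

variable {Ω : Type*} [MeasurableSpace Ω] {P : Measure Ω}

lemma dotProduct_self_eq_one {ι : Type*} [Fintype ι] {u : EuclideanSpace ℝ ι} (hu : ‖u‖ = 1) :
    u.ofLp ⬝ᵥ u.ofLp = 1 := by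
  rw [dotProduct_self_eq_norm_sq]
  exact (congrArg (· ^ 2) hu).trans (one_pow 2)

lemma measure_opNorm_gt_le [IsFiniteMeasure P] {ι κ : Type*} [Fintype ι] [Fintype κ] [DecidableEq κ]
    {X : Ω → Matrix ι κ ℝ} {B : ℝ} (hB : 0 ≤ B)
    (h : ∀ u v, u ⬝ᵥ u = 1 → v ⬝ᵥ v = 1 →
      P.real {ω | B ≤ u ⬝ᵥ (X ω *ᵥ v)} ≤ Real.exp (-B ^ 2 / 2)) :
    P {ω | 4 * B < ‖X ω‖} ≤
      ENNReal.ofReal (5 ^ Fintype.card ι * 5 ^ Fintype.card κ * Real.exp (-B ^ 2 / 2)) := by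
  obtain ⟨T₁, hc₁, hu₁, hT₁⟩ := exists_half_net (EuclideanSpace ℝ ι)
  obtain ⟨T₂, hc₂, hu₂, hT₂⟩ := exists_half_net (EuclideanSpace ℝ κ)
  rw [finrank_euclideanSpace] at hc₁ hc₂
  have hsub : {ω | 4 * B < ‖X ω‖} ⊆
      ⋃ p ∈ T₁ ×ˢ T₂, {ω | B ≤ p.1.ofLp ⬝ᵥ (X ω *ᵥ p.2.ofLp)} := by
    intro ω hω
    by_contra hcon
    simp only [Set.mem_iUnion, Set.mem_ofPred_eq, not_exists, not_le, Finset.mem_product] at hcon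
    refine absurd (Set.mem_ofPred_eq ▸ hω) (not_lt.2 ?_)
    rw [Matrix.l2_opNorm_def]
    refine opNorm_le_of_nets hT₁ hT₂ hB _ fun u hu v hv => (hcon (u, v) ⟨hu, hv⟩).le.trans' ?_
    rw [PiLp.inner_apply]
    exact (Finset.sum_congr rfl fun i _ => mul_comm _ _).le
  refine (measure_mono hsub).trans ((measure_biUnion_finset_le _ _).trans ?_)
  refine (Finset.sum_le_sum (g := fun _ => ENNReal.ofReal (Real.exp (-B ^ 2 / 2)))
    fun p hp => ?_).trans ?_
  · obtain ⟨h1, h2⟩ := Finset.mem_product.1 hp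
    rw [← ofReal_measureReal]
    exact ENNReal.ofReal_le_ofReal (h _ _ (dotProduct_self_eq_one (hu₁ _ h1))
      (dotProduct_self_eq_one (hu₂ _ h2)))
  · rw [Finset.sum_const, Finset.card_product, nsmul_eq_mul, ← ENNReal.ofReal_natCast,
      ← ENNReal.ofReal_mul (Nat.cast_nonneg _)]
    refine ENNReal.ofReal_le_ofReal (mul_le_mul_of_nonneg_right ?_ (Real.exp_nonneg _))
    exact_mod_cast Nat.mul_le_mul hc₁ hc₂

lemma hasSubgaussianMGF_of_hasLaw [IsProbabilityMeasure P] {X : Ω → ℝ}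
    (hX : HasLaw X (gaussianReal 0 1) P) : HasSubgaussianMGF X 1 P where
  integrable_exp_mul t := by
    have h := integrable_exp_mul_gaussianReal (μ := 0) (v := 1) t
    rw [← hX.map_eq] at h
    exact (integrable_map_measure h.aestronglyMeasurable hX.aemeasurable).1 h
  mgf_le t := by
    rw [mgf_gaussianReal hX.map_eq]; simp

lemma measureReal_linear_combination_ge_le {ι : Type*} [Fintype ι] {W : ι → Ω → ℝ}
    (hind : iIndepFun W P) (hlaw : ∀ i, HasLaw (W i) (gaussianReal 0 1) P) {c : ι → ℝ}
    (hc : ∑ i, c i ^ 2 = 1) {B : ℝ} (hB : 0 ≤ B) :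
    P.real {ω | B ≤ ∑ i, c i * W i ω} ≤ Real.exp (-B ^ 2 / 2) := by
  have : IsProbabilityMeasure P := hind.isProbabilityMeasure
  have hind' : iIndepFun (fun i ω => c i * W i ω) P :=
    hind.comp (fun i x => c i * x) fun i => measurable_const_mul (c i)
  have h := HasSubgaussianMGF.measure_sum_ge_le_of_iIndepFun hind' (s := Finset.univ)
    (fun i _ => (hasSubgaussianMGF_of_hasLaw (hlaw i)).const_mul (c i)) hB
  refine h.trans_eq ?_
  rw [NNReal.coe_sum]
  refine congrArg (fun x : ℝ => Real.exp (-B ^ 2 / x)) ((congrArg (2 * ·) ?_).trans (mul_one 2))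
  rw [← hc]
  exact Finset.sum_congr rfl fun i _ => mul_one (c i ^ 2)

/-- Covers both the stacked noise and a block times a fixed frame: in each, `u ⬝ᵥ (X *ᵥ v)` is a
combination of independent Gaussians with unit coefficient vector. Since `5 ≤ e ^ 2`, the net sizes
are absorbed by the condition on `B ^ 2`. -/
lemma measure_opNorm_gaussian_gt_le {ι : Type*} [Fintype ι] {W : ι → Ω → ℝ}
    (hind : iIndepFun W P) (hlaw : ∀ i, HasLaw (W i) (gaussianReal 0 1) P)
    {α β : Type*} [Fintype α] [Fintype β] [DecidableEq β]
    {X : Ω → Matrix α β ℝ} (c : (α → ℝ) → (β → ℝ) → ι → ℝ)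
    (hc : ∀ u v, u ⬝ᵥ u = 1 → v ⬝ᵥ v = 1 → ∑ i, c u v i ^ 2 = 1)
    (hX : ∀ ω u v, u ⬝ᵥ (X ω *ᵥ v) = ∑ i, c u v i * W i ω) {B s : ℝ} (hB : 0 ≤ B)
    (hBs : 4 * (Fintype.card α + Fintype.card β : ℝ) + 2 * s ≤ B ^ 2) :
    P {ω | 4 * B < ‖X ω‖} ≤ ENNReal.ofReal (Real.exp (-s)) := by
  have : IsProbabilityMeasure P := hind.isProbabilityMeasure
  refine (measure_opNorm_gt_le hB fun u v hu hv => ?_).trans (ENNReal.ofReal_le_ofReal ?_)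
  · simp_rw [hX]
    exact measureReal_linear_combination_ge_le hind hlaw (hc u v hu hv) hB
  · have h5 : ∀ k : ℕ, (5 : ℝ) ^ k ≤ Real.exp (2 * k) := fun k => by
      rw [mul_comm, Real.exp_nat_mul]
      refine pow_le_pow_left₀ (by norm_num) ?_ k
      have h1 : (5 / 2 : ℝ) ≤ Real.exp 1 := by linarith [Real.exp_one_gt_d9]
      have h2 : Real.exp 2 = Real.exp 1 * Real.exp 1 := by rw [← Real.exp_add]; norm_num
      nlinarith
    calc (5 : ℝ) ^ Fintype.card α * 5 ^ Fintype.card β * Real.exp (-B ^ 2 / 2)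
        ≤ Real.exp (2 * Fintype.card α) * Real.exp (2 * Fintype.card β)
          * Real.exp (-B ^ 2 / 2) := by gcongr <;> exact h5 _
      _ = Real.exp (2 * Fintype.card α + 2 * Fintype.card β + -B ^ 2 / 2) := by
          rw [Real.exp_add, Real.exp_add]
      _ ≤ Real.exp (-s) := Real.exp_le_exp.2 (by linarith)

variable {n d m : ℕ} {W : Fin n → Fin d → Fin m → Ω → ℝ}

lemma measure_norm_stack_gt_le
    (hind : iIndepFun (fun p : Fin n × Fin d × Fin m => W p.1 p.2.1 p.2.2) P)
    (hlaw : ∀ i a b, HasLaw (W i a b) (gaussianReal 0 1) P) {B s : ℝ} (hB : 0 ≤ B)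
    (hBs : 4 * ((n : ℝ) * d + m) + 2 * s ≤ B ^ 2) :
    P {ω | 4 * B < ‖stack fun i => Matrix.of fun a b => W i a b ω‖} ≤
      ENNReal.ofReal (Real.exp (-s)) := by
  refine measure_opNorm_gaussian_gt_le hind (fun p => hlaw _ _ _)
    (fun u v p => u (p.1, p.2.1) * v p.2.2) (fun u v hu hv => ?_) (fun ω u v => ?_) hB
    (by simpa using hBs)
  · simp only [dotProduct, Fintype.sum_prod_type] at hu hv
    have e : ∀ x y : ℝ, (x * y) ^ 2 = x * x * (y * y) := fun x y => by ring
    simp only [Fintype.sum_prod_type, e, ← Finset.mul_sum, hv, mul_one, hu]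
  · simp only [dotProduct, Matrix.mulVec, Fintype.sum_prod_type, Finset.mul_sum, stack,
      Matrix.of_apply]
    refine Finset.sum_congr rfl fun i _ => Finset.sum_congr rfl fun a _ =>
      Finset.sum_congr rfl fun b _ => by ring

/-- The nets live in dimension `d` on both sides and `V *ᵥ v` stays a unit vector, so `m` does not
enter the bound. -/
lemma measure_norm_block_mul_gt_le
    (hind : iIndepFun (fun p : Fin n × Fin d × Fin m => W p.1 p.2.1 p.2.2) P)
    (hlaw : ∀ i a b, HasLaw (W i a b) (gaussianReal 0 1) P) (i : Fin n)
    {V : Matrix (Fin m) (Fin d) ℝ} (hV : Vᵀ * V = 1) {B s : ℝ} (hB : 0 ≤ B)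
    (hBs : 8 * (d : ℝ) + 2 * s ≤ B ^ 2) :
    P {ω | 4 * B < ‖(Matrix.of fun a b => W i a b ω) * V‖} ≤ ENNReal.ofReal (Real.exp (-s)) := by
  have hinj : Function.Injective fun q : Fin d × Fin m => (i, q) := fun q q' h => by
    simpa using h
  refine measure_opNorm_gaussian_gt_le (hind.precomp hinj) (fun p => hlaw _ _ _)
    (fun u v p => u p.1 * (V *ᵥ v) p.2) (fun u v hu hv => ?_) (fun ω u v => ?_) hB ?_
  · rw [← orthonormal_mulVec_sq hV] at hv
    simp only [dotProduct] at hu hv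
    have e : ∀ x y : ℝ, (x * y) ^ 2 = x * x * (y * y) := fun x y => by ring
    simp only [Fintype.sum_prod_type, e, ← Finset.mul_sum, hv, mul_one, hu]
  · rw [← Matrix.mulVec_mulVec]
    simp only [Fintype.sum_prod_type]
    generalize V *ᵥ v = x
    simp only [dotProduct, Matrix.mulVec, Finset.mul_sum, Matrix.of_apply]
    refine Finset.sum_congr rfl fun a _ => Finset.sum_congr rfl fun b _ => by ring
  · simp only [Fintype.card_fin]; linarith

end Tails

/-! ### Independence of a noise block from the leave-one-out frame -/

section LeaveOneOut

variable {Ω : Type*} [MeasurableSpace Ω] {P : Measure Ω} {n d m : ℕ}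

/-- Fubini for the product law: independence permits conditioning on `Y`. -/
lemma measure_pair_mem_le_of_slices {α β : Type*} [MeasurableSpace α] [MeasurableSpace β]
    [IsProbabilityMeasure P] {X : Ω → α} {Y : Ω → β} (hX : AEMeasurable X P)
    (hY : AEMeasurable Y P) (hXY : IndepFun X Y P) {S : Set (α × β)} (hS : MeasurableSet S)
    {δ : ENNReal} (h : ∀ y, P {ω | (X ω, y) ∈ S} ≤ δ) : P {ω | (X ω, Y ω) ∈ S} ≤ δ := by
  have : IsProbabilityMeasure (P.map X) := Measure.isProbabilityMeasure_map hX
  have : IsProbabilityMeasure (P.map Y) := Measure.isProbabilityMeasure_map hY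
  have h1 : P {ω | (X ω, Y ω) ∈ S} = ((P.map X).prod (P.map Y)) S := by
    rw [← (indepFun_iff_map_prod_eq_prod_map_map hX hY).1 hXY,
      Measure.map_apply_of_aemeasurable (hX.prodMk hY) hS]
    rfl
  rw [h1, Measure.prod_apply_symm hS]
  calc ∫⁻ y, P.map X ((fun x => (x, y)) ⁻¹' S) ∂(P.map Y) ≤ ∫⁻ _, δ ∂(P.map Y) := by
        refine lintegral_mono fun y => ?_
        rw [Measure.map_apply_of_aemeasurable hX (measurable_prodMk_right hS)]
        exact h y
    _ = δ := by simp

lemma isCompact_orthonormal (κ : Type*) [Fintype κ] (d : ℕ) :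
    IsCompact {V : Matrix κ (Fin d) ℝ | Vᵀ * V = 1} := by
  have hsub : {V : Matrix κ (Fin d) ℝ | Vᵀ * V = 1} ⊆
      Set.pi Set.univ fun _ => Set.pi Set.univ fun _ => Set.Icc (-1 : ℝ) 1 := by
    intro V hV i _ j _
    have h := congrFun (congrFun hV j) j
    simp only [Matrix.mul_apply, Matrix.transpose_apply, Matrix.one_apply_eq] at h
    have h1 : V i j * V i j ≤ 1 := by
      rw [← h]
      exact Finset.single_le_sum (f := fun k => V k j * V k j) (fun k _ => mul_self_nonneg _)
        (Finset.mem_univ i)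
    exact abs_le.1 (abs_le_one_iff_mul_self_le_one.2 h1)
  refine IsCompact.of_isClosed_subset
    (isCompact_univ_pi fun _ => isCompact_univ_pi fun _ => isCompact_Icc) ?_ hsub
  exact isClosed_eq (by fun_prop) continuous_const

/-- Quantifying over all frames avoids a measurable choice of singular vectors. The set is closed
because it is obtained by projecting a closed set along the compact set of orthonormal frames; the
non-strict inequalities matter here. -/
lemma isClosed_exists_frame_norm_ge (O : Fin n → Matrix (Fin d) (Fin d) ℝ)
    (A : Matrix (Fin d) (Fin m) ℝ) (σ a w t : ℝ) :
    IsClosed {p : (Fin d → Fin m → ℝ) × (Fin n → Fin d → Fin m → ℝ) |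
      ‖stack fun j => Matrix.of (p.2 j)‖ ≤ w ∧ ∃ V : Matrix (Fin m) (Fin d) ℝ,
        IsTopFrame (dataMatrix O A σ fun j => Matrix.of (p.2 j)) a V ∧
          t ≤ ‖Matrix.of p.1 * V‖} := by
  have : CompactSpace {V : Matrix (Fin m) (Fin d) ℝ | Vᵀ * V = 1} :=
    isCompact_iff_compactSpace.1 (isCompact_orthonormal _ _)
  have hstack : Continuous fun y : Fin n → Fin d → Fin m → ℝ =>
      stack fun j => Matrix.of (y j) := by
    refine continuous_matrix fun p b => ?_
    simp only [stack, Matrix.of_apply]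
    fun_prop
  have hdata : Continuous fun y : Fin n → Fin d → Fin m → ℝ =>
      dataMatrix O A σ fun j => Matrix.of (y j) := by
    simp_rw [dataMatrix_eq_add]
    fun_prop
  refine IsClosed.inter (isClosed_le (hstack.comp continuous_snd).norm continuous_const) ?_
  let Z : Set (((Fin d → Fin m → ℝ) × (Fin n → Fin d → Fin m → ℝ)) ×
      {V : Matrix (Fin m) (Fin d) ℝ | Vᵀ * V = 1}) :=
    {q | IsTopFrame (dataMatrix O A σ fun j => Matrix.of (q.1.2 j)) a q.2.1 ∧
      t ≤ ‖Matrix.of q.1.1 * q.2.1‖}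
  have hV : Continuous fun q : ((Fin d → Fin m → ℝ) × (Fin n → Fin d → Fin m → ℝ)) ×
      {V : Matrix (Fin m) (Fin d) ℝ | Vᵀ * V = 1} => q.2.1 :=
    continuous_subtype_val.comp continuous_snd
  have hD : Continuous fun q : ((Fin d → Fin m → ℝ) × (Fin n → Fin d → Fin m → ℝ)) ×
      {V : Matrix (Fin m) (Fin d) ℝ | Vᵀ * V = 1} =>
      dataMatrix O A σ fun j => Matrix.of (q.1.2 j) :=
    hdata.comp (continuous_snd.comp continuous_fst)
  have hX : Continuous fun q : ((Fin d → Fin m → ℝ) × (Fin n → Fin d → Fin m → ℝ)) ×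
      {V : Matrix (Fin m) (Fin d) ℝ | Vᵀ * V = 1} => Matrix.of q.1.1 :=
    continuous_fst.comp continuous_fst
  have hZ : IsClosed Z := by
    refine IsClosed.inter (IsClosed.inter ?_ (IsClosed.inter ?_ ?_)) ?_
    · exact isClosed_eq (hV.matrix_transpose.matrix_mul hV) continuous_const
    · have h1 := (hD.matrix_transpose.matrix_mul hD).matrix_mul hV
      exact isClosed_eq h1 (hV.matrix_mul (hV.matrix_transpose.matrix_mul h1))
    · have : ∀ y : Fin d → ℝ, IsClosed {q : ((Fin d → Fin m → ℝ) × (Fin n → Fin d → Fin m → ℝ)) ×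
          {V : Matrix (Fin m) (Fin d) ℝ | Vᵀ * V = 1} | a * (y ⬝ᵥ y) ≤
            (dataMatrix O A σ (fun j => Matrix.of (q.1.2 j)) *ᵥ (q.2.1 *ᵥ y)) ⬝ᵥ
            (dataMatrix O A σ (fun j => Matrix.of (q.1.2 j)) *ᵥ (q.2.1 *ᵥ y))} := fun y => by
        have h1 := hD.matrix_mulVec (hV.matrix_mulVec (continuous_const (y := y)))
        exact isClosed_le continuous_const (h1.dotProduct h1)
      have h2 := isClosed_iInter this
      rwa [← Set.ofPred_forall] at h2
    · exact isClosed_le continuous_const (hX.matrix_mul hV).norm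
  have himg := isClosedMap_fst_of_compactSpace _ hZ
  refine (congrArg IsClosed (Set.ext fun p => ?_)).mp himg
  refine Iff.symm ⟨?_, ?_⟩
  · rintro ⟨V, hVf, ht⟩
    exact ⟨(p, ⟨V, hVf.1⟩), ⟨hVf, ht⟩, rfl⟩
  · rintro ⟨⟨p, V⟩, ⟨h1, h2⟩, rfl⟩
    exact ⟨V, h1, h2⟩

variable {W : Fin n → Fin d → Fin m → Ω → ℝ}

lemma indepFun_block_update
    (hind : iIndepFun (fun p : Fin n × Fin d × Fin m => W p.1 p.2.1 p.2.2) P)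
    (hmeas : ∀ i a b, AEMeasurable (W i a b) P) (i : Fin n) :
    IndepFun (fun ω a b => W i a b ω)
      (fun ω => Function.update (fun j a b => W j a b ω) i (0 : Fin d → Fin m → ℝ)) P := by
  classical
  let S : Finset (Fin n × Fin d × Fin m) := Finset.univ.filter fun p => p.1 = i
  let T : Finset (Fin n × Fin d × Fin m) := Finset.univ.filter fun p => p.1 ≠ i
  have hST : Disjoint S T := Finset.disjoint_filter_filter_not _ _ _
  have h := hind.indepFun_finset₀ S T hST fun p => hmeas _ _ _
  let φ : (S → ℝ) → Fin d → Fin m → ℝ := fun x a b => x ⟨(i, a, b), by simp [S]⟩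
  let ψ : (T → ℝ) → Fin n → Fin d → Fin m → ℝ := fun y j a b =>
    if hj : j ≠ i then y ⟨(j, a, b), by simpa [T] using hj⟩ else 0
  have hφ : Measurable φ := by
    refine measurable_pi_lambda _ fun a => measurable_pi_lambda _ fun b => measurable_pi_apply _
  have hψ : Measurable ψ := by
    refine measurable_pi_lambda _ fun j => measurable_pi_lambda _ fun a =>
      measurable_pi_lambda _ fun b => ?_
    by_cases hj : j ≠ i
    · simp only [ψ, hj, dite_true, ne_eq, not_false_eq_true]; exact measurable_pi_apply _
    · simp only [ψ, hj, dite_false]; exact measurable_const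
  have e : (fun ω => Function.update (fun j a b => W j a b ω) i (0 : Fin d → Fin m → ℝ)) =
      ψ ∘ fun ω (p : T) => W p.1.1 p.1.2.1 p.1.2.2 ω := ?_
  · rw [e]; exact h.comp hφ hψ
  funext ω j a b
  by_cases hj : j = i
  · subst hj; simp [ψ]
  · simp [ψ, hj]

/-- Freeze all blocks but the `i`-th. Either no frame is admissible and the slice is empty, or one
fixed `V₀` dominates all frames by uniqueness, and the tail for `Wᵢ V₀` applies. The norm constraint
omits block `i`, so it is decided by the frozen data; it supplies the gap behind uniqueness. -/
lemma measure_exists_frame_norm_ge_le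
    (hind : iIndepFun (fun p : Fin n × Fin d × Fin m => W p.1 p.2.1 p.2.2) P)
    (hlaw : ∀ i a b, HasLaw (W i a b) (gaussianReal 0 1) P)
    (O : Fin n → Matrix (Fin d) (Fin d) ℝ) (A : Matrix (Fin d) (Fin m) ℝ) {σ a w t : ℝ}
    (hσ : 0 ≤ σ) (hwa : (σ * w) ^ 2 < a) (i : Fin n) {B s : ℝ} (hB : 0 ≤ B) (hBt : 4 * B < t)
    (hBs : 8 * (d : ℝ) + 2 * s ≤ B ^ 2) :
    P {ω | ‖stack (Function.update (fun j => Matrix.of fun a b => W j a b ω) i 0)‖ ≤ w ∧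
      ∃ V : Matrix (Fin m) (Fin d) ℝ, IsTopFrame (dataMatrix O A σ
        (Function.update (fun j => Matrix.of fun a b => W j a b ω) i 0)) a V ∧
          t ≤ ‖(Matrix.of fun a b => W i a b ω) * V‖} ≤ ENNReal.ofReal (Real.exp (-s)) := by
  have : IsProbabilityMeasure P := hind.isProbabilityMeasure
  have hmeas : ∀ i a b, AEMeasurable (W i a b) P := fun i a b => (hlaw i a b).aemeasurable
  refine measure_pair_mem_le_of_slices (X := fun ω a b => W i a b ω)
    (Y := fun ω => Function.update (fun j a b => W j a b ω) i (0 : Fin d → Fin m → ℝ)) ?_ ?_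
    (indepFun_block_update hind hmeas i)
    (isClosed_exists_frame_norm_ge O A σ a w t).measurableSet fun y => ?_
  · exact aemeasurable_pi_lambda _ fun a => aemeasurable_pi_lambda _ fun b => hmeas _ _ _
  · refine aemeasurable_pi_lambda _ fun j => aemeasurable_pi_lambda _ fun a =>
      aemeasurable_pi_lambda _ fun b => ?_
    by_cases hj : j = i
    · subst hj; simp
    · simpa [hj] using hmeas j a b
  · by_cases hy : ‖stack fun j => Matrix.of (y j)‖ ≤ w ∧ ∃ V : Matrix (Fin m) (Fin d) ℝ,
        IsTopFrame (dataMatrix O A σ fun j => Matrix.of (y j)) a V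
    · obtain ⟨hyw, V₀, hV₀⟩ := hy
      refine (measure_mono ?_).trans (measure_norm_block_mul_gt_le hind hlaw i hV₀.1 hB hBs)
      rintro ω ⟨-, V, hV, hVt⟩
      have hE : ‖σ • stack fun j => Matrix.of (y j)‖ ≤ σ * w := by
        rw [norm_smul, Real.norm_of_nonneg hσ]; gcongr
      rw [hV₀.eq_mul_of_isTopFrame (dataMatrix_eq_add O A σ _) hE hwa hV, ← Matrix.mul_assoc] at hVt
      refine hBt.trans_le (hVt.trans ((Matrix.l2_opNorm_mul _ _).trans
        (mul_le_of_le_one_right (norm_nonneg _) ?_)))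
      refine (Matrix.l2_opNorm_mul _ _).trans (mul_le_one₀ ?_ (norm_nonneg _)
        (orthonormal_norm_le hV.1))
      rw [l2_opNorm_transpose]; exact orthonormal_norm_le hV₀.1
    · have : {ω | ((fun a b => W i a b ω), y) ∈
          {p : (Fin d → Fin m → ℝ) × (Fin n → Fin d → Fin m → ℝ) |
            ‖stack fun j => Matrix.of (p.2 j)‖ ≤ w ∧ ∃ V : Matrix (Fin m) (Fin d) ℝ,
            IsTopFrame (dataMatrix O A σ fun j => Matrix.of (p.2 j)) a V ∧
              t ≤ ‖Matrix.of p.1 * V‖}} = ∅ := by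
        ext ω
        simp only [Set.mem_ofPred_eq, Set.mem_empty_iff_false, iff_false]
        rintro ⟨h1, V, h2, -⟩
        exact hy ⟨h1, V, h2⟩
      rw [this]; simp

end LeaveOneOut

/-! ### Arithmetic of the noise scale -/

section NoiseScale

variable {n d m : ℕ} {γ : ℝ}

lemma noiseScale_pos (hn : 1 ≤ n) (hd : 1 ≤ d) : 0 < noiseScale n d m γ := by
  have : 0 < √((n : ℝ) * d) := Real.sqrt_pos.2 (by
    have : (0 : ℝ) < n := by exact_mod_cast hn
    have : (0 : ℝ) < d := by exact_mod_cast hd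
    positivity)
  unfold noiseScale
  positivity

lemma stack_scale_le (hn : 1 ≤ n) (hγ : 0 ≤ γ) :
    4 * ((n : ℝ) * d + m) + 2 * (γ * Real.log n) ≤ (2 * noiseScale n d m γ) ^ 2 := by
  have hn' : (1 : ℝ) ≤ n := by exact_mod_cast hn
  have hlog : 0 ≤ γ * Real.log n := mul_nonneg hγ (Real.log_nonneg hn')
  have h1 := Real.sq_sqrt (show 0 ≤ (n : ℝ) * d by positivity)
  have h2 := Real.sq_sqrt (show 0 ≤ (m : ℝ) by positivity)
  have e3 : 2 * γ * n * Real.log n = 2 * n * (γ * Real.log n) := by ring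
  have h3 := Real.sq_sqrt (show 0 ≤ 2 * γ * n * Real.log n by rw [e3]; positivity)
  have h4 : γ * Real.log n ≤ n * (γ * Real.log n) := le_mul_of_one_le_left hlog hn'
  unfold noiseScale
  nlinarith [mul_nonneg (Real.sqrt_nonneg ((n : ℝ) * d)) (Real.sqrt_nonneg (m : ℝ)),
    mul_nonneg (Real.sqrt_nonneg ((n : ℝ) * d)) (Real.sqrt_nonneg (2 * γ * n * Real.log n)),
    mul_nonneg (Real.sqrt_nonneg (m : ℝ)) (Real.sqrt_nonneg (2 * γ * n * Real.log n))]

lemma block_scale_le (hn : 1 ≤ n) (hγ : 0 ≤ γ) :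
    8 * (d : ℝ) + 2 * (γ * Real.log n) ≤ (3 * (noiseScale n d m γ / √n)) ^ 2 := by
  have hn' : (1 : ℝ) ≤ n := by exact_mod_cast hn
  have hlog : 0 ≤ γ * Real.log n := mul_nonneg hγ (Real.log_nonneg hn')
  have e : (3 * (noiseScale n d m γ / √n)) ^ 2 = 9 * noiseScale n d m γ ^ 2 / n := by
    rw [mul_pow, div_pow, Real.sq_sqrt (by linarith)]; ring
  rw [e, le_div_iff₀ (by linarith)]
  have h1 := Real.sq_sqrt (show 0 ≤ (n : ℝ) * d by positivity)
  have e3 : 2 * γ * n * Real.log n = 2 * n * (γ * Real.log n) := by ring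
  have h3 := Real.sq_sqrt (show 0 ≤ 2 * γ * n * Real.log n by rw [e3]; positivity)
  have h4 : (0 : ℝ) ≤ n * d := by positivity
  have h5 : 0 ≤ n * (γ * Real.log n) := by positivity
  have h6 : √((n : ℝ) * d) ^ 2 + √(2 * γ * n * Real.log n) ^ 2 ≤ noiseScale n d m γ ^ 2 := by
    unfold noiseScale
    nlinarith [mul_nonneg (Real.sqrt_nonneg ((n : ℝ) * d)) (Real.sqrt_nonneg (m : ℝ)),
      mul_nonneg (Real.sqrt_nonneg ((n : ℝ) * d)) (Real.sqrt_nonneg (2 * γ * n * Real.log n)),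
      mul_nonneg (Real.sqrt_nonneg (m : ℝ)) (Real.sqrt_nonneg (2 * γ * n * Real.log n)),
      sq_nonneg √(m : ℝ)]
  rw [h1, h3] at h6
  nlinarith

lemma one_le_condNumber {A : Matrix (Fin d) (Fin m) ℝ} (hA : 0 < sigmaMin A) :
    1 ≤ condNumber A := by
  rw [condNumber, one_le_div hA]
  exact sigmaMin_le_sigmaMax A

/-- Replacing `σ_max` by `κ σ_min` spends one of the four powers of `κ`; the other three are at
least `1` and are dropped. -/
lemma mul_noiseScale_mul_sigmaMax_le (hn : 1 ≤ n) (hd : 1 ≤ d) {A : Matrix (Fin d) (Fin m) ℝ}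
    (hA : 0 < sigmaMin A) {σ c : ℝ} (hc : 0 ≤ c)
    (hσ : σ ≤ c * (sigmaMin A / condNumber A ^ 4 * (√(n : ℝ) / noiseScale n d m γ))) :
    σ * noiseScale n d m γ * sigmaMax A ≤ c * (√(n : ℝ) * sigmaMin A ^ 2) := by
  have hκ := one_le_condNumber hA
  have hL : 0 < noiseScale n d m γ := noiseScale_pos hn hd
  have hM : sigmaMax A = condNumber A * sigmaMin A := by rw [condNumber]; field_simp
  have hM0 : 0 ≤ sigmaMax A := by rw [hM]; positivity
  calc σ * noiseScale n d m γ * sigmaMax A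
      ≤ c * (sigmaMin A / condNumber A ^ 4 * (√(n : ℝ) / noiseScale n d m γ))
        * noiseScale n d m γ * sigmaMax A := by gcongr
    _ = c * (√(n : ℝ) * sigmaMin A ^ 2) / condNumber A ^ 3 := by rw [hM]; field_simp
    _ ≤ c * (√(n : ℝ) * sigmaMin A ^ 2) := div_le_self (by positivity) (one_le_pow₀ hκ)

end NoiseScale

/-! ### The high-probability event -/

section Main

variable {n d m : ℕ} {γ : ℝ} {Ω : Type*} [MeasurableSpace Ω] {P : Measure Ω}
  {W : Fin n → Fin d → Fin m → Ω → ℝ}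

/-- Outside an event of probability at most `2 n ^ (2 - γ)` the noise is small, and every block of
it nearly kills the top frames of the data without that block. -/
lemma exists_event_noise_small (hn : 1 ≤ n) (hd : 1 ≤ d) (hγ : 0 ≤ γ)
    (hind : iIndepFun (fun p : Fin n × Fin d × Fin m => W p.1 p.2.1 p.2.2) P)
    (hlaw : ∀ i a b, HasLaw (W i a b) (gaussianReal 0 1) P)
    (O : Fin n → Matrix (Fin d) (Fin d) ℝ) (A : Matrix (Fin d) (Fin m) ℝ) {σ a : ℝ} (hσ : 0 ≤ σ)
    (ha : (σ * (8 * noiseScale n d m γ)) ^ 2 < a) :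
    ∃ E : Set Ω, MeasurableSet E ∧ 1 - 2 * (n : ℝ) ^ (-γ + 2) ≤ P.real E ∧ ∀ ω ∈ E,
      ‖stack fun i => Matrix.of fun a b => W i a b ω‖ ≤ 8 * noiseScale n d m γ ∧
      ∀ i, ∀ V : Matrix (Fin m) (Fin d) ℝ, IsTopFrame (dataMatrix O A σ
        (Function.update (fun j => Matrix.of fun a b => W j a b ω) i 0)) a V →
          ‖(Matrix.of fun a b => W i a b ω) * V‖ ≤ 15 * (noiseScale n d m γ / √n) := by
  have : IsProbabilityMeasure P := hind.isProbabilityMeasure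
  have hn' : (1 : ℝ) ≤ n := by exact_mod_cast hn
  have hL : 0 < noiseScale n d m γ := noiseScale_pos hn hd
  have hℓ : 0 < noiseScale n d m γ / √n := by positivity
  set L := noiseScale n d m γ with hLdef
  set X : Ω → Fin n → Matrix (Fin d) (Fin m) ℝ := fun ω i => Matrix.of fun a b => W i a b ω
  set δ := Real.exp (-(γ * Real.log n)) with hδ
  let B₀ : Set Ω := {ω | 4 * (2 * L) < ‖stack (X ω)‖}
  -- The tail bound has threshold `4 · 3 = 12` times `L / √n`; `15` leaves the strict room it
  -- requires.
  let B₁ : Fin n → Set Ω := fun i => {ω | ‖stack (Function.update (X ω) i 0)‖ ≤ 8 * L ∧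
    ∃ V : Matrix (Fin m) (Fin d) ℝ, IsTopFrame (dataMatrix O A σ (Function.update (X ω) i 0)) a V ∧
      15 * (L / √n) ≤ ‖X ω i * V‖}
  have hB₀ : P B₀ ≤ ENNReal.ofReal δ :=
    measure_norm_stack_gt_le hind hlaw (by positivity) (stack_scale_le hn hγ)
  have hB₁ : ∀ i, P (B₁ i) ≤ ENNReal.ofReal δ := fun i =>
    measure_exists_frame_norm_ge_le hind hlaw O A hσ ha i (B := 3 * (L / √n)) (by positivity)
      (by linarith) (block_scale_le hn hγ)
  set bad := B₀ ∪ ⋃ i, B₁ i with hbad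
  have hPbad : P bad ≤ ENNReal.ofReal ((1 + n) * δ) := by
    refine (measure_union_le _ _).trans ?_
    rw [add_mul, one_mul, ENNReal.ofReal_add (Real.exp_nonneg _) (by positivity)]
    refine add_le_add hB₀ ((measure_iUnion_fintype_le _ _).trans
      ((Finset.sum_le_sum fun i _ => hB₁ i).trans_eq ?_))
    rw [Finset.sum_const, Finset.card_univ, Fintype.card_fin, nsmul_eq_mul,
      ENNReal.ofReal_mul (Nat.cast_nonneg n), ENNReal.ofReal_natCast]
  have hδn : (1 + n) * δ ≤ 2 * (n : ℝ) ^ (-γ + 2) := by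
    have e : δ = (n : ℝ) ^ (-γ) := by
      rw [Real.rpow_def_of_pos (by linarith), hδ]; congr 1; ring
    rw [e, Real.rpow_add (by linarith), Real.rpow_two]
    have : (0 : ℝ) ≤ (n : ℝ) ^ (-γ) := by positivity
    have h2 : 1 + (n : ℝ) ≤ 2 * (n : ℝ) ^ 2 := by nlinarith
    linarith [mul_le_mul_of_nonneg_right h2 this]
  -- The entries are only almost everywhere measurable, so `bad` is replaced by a measurable hull of
  -- the same measure.
  refine ⟨(toMeasurable P bad)ᶜ, (measurableSet_toMeasurable P bad).compl, ?_, fun ω hω => ?_⟩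
  · rw [probReal_compl_eq_one_sub (measurableSet_toMeasurable P bad), measureReal_def,
      measure_toMeasurable]
    have := ENNReal.toReal_le_of_le_ofReal (by positivity) hPbad
    linarith
  · have hω' : ω ∉ bad := fun h => hω (subset_toMeasurable P bad h)
    rw [hbad, Set.mem_union, Set.mem_iUnion, not_or, not_exists] at hω'
    have h0 : ‖stack (X ω)‖ ≤ 8 * L := by
      have : ‖stack (X ω)‖ ≤ 4 * (2 * L) := not_lt.1 hω'.1
      linarith
    refine ⟨h0, fun i V hV => ?_⟩
    by_contra! hcon
    exact hω'.2 i ⟨(norm_stack_update_zero_le (X ω) i).trans h0, V, hV, hcon.le⟩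

end Main

end Procrustes

theorem theorem3p1 :
    ∃ c C C' : ℝ, 0 < c ∧ 0 < C ∧ 0 < C' ∧
      ∀ (n d m : ℕ), 1 ≤ n → 1 ≤ d → d ≤ m →
      ∀ (γ : ℝ), 0 ≤ γ →
      ∀ (A : Matrix (Fin d) (Fin m) ℝ), 0 < Procrustes.sigmaMin A →
      ∀ (O : Fin n → Matrix (Fin d) (Fin d) ℝ),
        (∀ i, O i ∈ Matrix.orthogonalGroup (Fin d) ℝ) →
      ∀ (σ : ℝ), 0 ≤ σ →
        σ ≤ c * (Procrustes.sigmaMin A / Procrustes.condNumber A ^ 4 *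
          (√(n : ℝ) / Procrustes.noiseScale n d m γ)) →
      ∀ (Ω : Type*) [MeasurableSpace Ω] (P : Measure Ω) [IsProbabilityMeasure P]
        (W : Fin n → Fin d → Fin m → Ω → ℝ),
        iIndepFun (fun (p : Fin n × Fin d × Fin m) => W p.1 p.2.1 p.2.2) P →
        (∀ i a b, HasLaw (W i a b) (gaussianReal 0 1) P) →
        ∃ E : Set Ω, MeasurableSet E ∧ 1 - C' * (n : ℝ) ^ (-γ + 2) ≤ P.real E ∧
          ∀ ω ∈ E, ∀ S : Fin n → Matrix (Fin d) (Fin d) ℝ,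
            Procrustes.IsSpectralEstimator
              (Procrustes.dataMatrix O A σ (fun i => Matrix.of fun a b => W i a b ω)) S →
            ∃ Q ∈ Matrix.orthogonalGroup (Fin d) ℝ, ∀ i,
              ‖S i - O i * Q‖ ≤
                C * (σ * Procrustes.condNumber A ^ 2 / Procrustes.sigmaMin A *
                  (Procrustes.noiseScale n d m γ / √(n : ℝ))) := by
  -- With `w = 8 L` and `t = 15 L / √n`: `800 = 100 · 8` comes from the smallness condition on `σ w
  -- σ_max`, and `1520 = 40 · 38` with `38 = 2 · 15 + 8`.
  refine ⟨1 / 800, 1520, 2, by norm_num, by norm_num, by norm_num, ?_⟩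
  intro n d m hn hd hdm γ hγ A hA O hO σ hσ hσle Ω _ P _ W hind hlaw
  have hn' : (1 : ℝ) ≤ n := by exact_mod_cast hn
  have hscale := Procrustes.mul_noiseScale_mul_sigmaMax_le hn hd hA (by norm_num) hσle
  have hL : 0 < Procrustes.noiseScale n d m γ := Procrustes.noiseScale_pos hn hd
  have hκ := Procrustes.one_le_condNumber hA
  have hmm := Procrustes.sigmaMin_le_sigmaMax A
  set L := Procrustes.noiseScale n d m γ
  set μ := Procrustes.sigmaMin A
  have hσL : 800 * (σ * L) ≤ √(n : ℝ) * μ := by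
    refine le_of_mul_le_mul_right ?_ hA
    calc 800 * (σ * L) * μ ≤ 800 * (σ * L) * Procrustes.sigmaMax A := by gcongr
      _ ≤ √(n : ℝ) * μ * μ := by linarith
  have hρ : 0 < √(n : ℝ) * μ := by positivity
  have ha : (σ * (8 * L)) ^ 2 < n * μ ^ 2 / 2 := by
    have h1 : (σ * (8 * L)) ^ 2 ≤ (√(n : ℝ) * μ / 100) ^ 2 :=
      pow_le_pow_left₀ (by positivity) (by linarith) 2
    have h2 : (√(n : ℝ) * μ / 100) ^ 2 = n * μ ^ 2 / 10000 := by
      rw [div_pow, mul_pow, Real.sq_sqrt (by linarith)]; norm_num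
    have h3 : 0 < n * μ ^ 2 := by positivity
    linarith
  obtain ⟨E, hE, hPE, h⟩ :=
    Procrustes.exists_event_noise_small hn hd hγ hind hlaw O A hσ ha
  refine ⟨E, hE, hPE, fun ω hω S hS => ?_⟩
  obtain ⟨hW, ht⟩ := h ω hω
  have hx : 2 * (15 * (L / √(n : ℝ))) + 8 * L / √(n : ℝ) = 38 * (L / √(n : ℝ)) := by ring
  have hsmall : 20 * (σ * (38 * (L / √(n : ℝ)))) ≤ μ := by
    have : σ * L / √(n : ℝ) ≤ μ / 800 := by
      rw [div_le_iff₀ (by positivity)]; linarith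
    have e : 20 * (σ * (38 * (L / √(n : ℝ)))) = 760 * (σ * L / √(n : ℝ)) := by ring
    rw [e]; linarith
  obtain ⟨Q, hQ, hSQ⟩ := hS.exists_orthogonal_close hn hdm hA hO hσ hW (by linarith) ht
    (by rw [hx]; exact hsmall)
  refine ⟨Q, hQ, fun i => (hSQ i).trans ?_⟩
  rw [hx]
  -- The estimate so far is free of `κ`; the factor `κ ^ 2 ≥ 1` enters only in the last inequality.
  calc 40 * (σ * (38 * (L / √(n : ℝ))) / μ) = 1520 * (σ * 1 / μ * (L / √(n : ℝ))) := by ring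
    _ ≤ _ := by gcongr; exact one_le_pow₀ hκ
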